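/- Let $(M,g,I,J,K)$ be a hyperkähler manifold of real dimension $4n$ (so $IJ=K$, etc., and $g$ is Kähler for each of $I,J,K$), with Kähler forms $\omega_A=g(A\,\cdot,\cdot)$, regarded as maps $T\to T^*$, $X\mapsto\iota_X\omega_A$. Put $\sigma=\omega_J+i\omega_K$. For $\eta\in\mathbb{CP}^1=\mathbb{C}\cup\{\infty\}$ let $$I_\eta=\tfrac{1-|\eta|^2}{1+|\eta|^2}I+\tfrac{2\mathrm{Re}\,\eta}{1+|\eta|^2}J+\tfrac{2\mathrm{Im}\,\eta}{1+|\eta|^2}K,\qquad I_\infty=-I,\qquad \omega_\eta=g(I_\eta\,\cdot,\cdot).$$ A generalized complex structure is a smooth endomorphism $\mathcal{J}$ of $T\oplus T^*$, orthogonal for $\langle X+\xi,Y+\tau\rangle=\frac12(\xi(Y)+\tau(X))$, with $\mathcal{J}^2=-1$, whose $+i$-eigenbundle $L\subset(T\oplus T^*)\otimes\mathbb{C}$ is closed under the bracket $[X+\xi,Y+\tau]=[X,Y]+\mathcal{L}_X\tau-\iota_Yd\xi$. A complex form $\Phi$, nowhere zero, is a pure spinor for $\mathcal{J}$ if at every point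 the annihilator of $\Phi$ under $(X+\xi)\cdot\Phi=\iota_X\Phi+\xi\wedge\Phi$ is exactly $L$. Write $\mathcal{J}_A=\begin{pmatrix}-A&0\\0&A^*\end{pmatrix}$ for a complex structure $A$ and $\mathcal{J}_\omega=\begin{pmatrix}0&-\omega^{-1}\\ \omega&0\end{pmatrix}$ for a symplectic form $\omega$. For $\alpha,\beta\in\mathbb{CP}^1$ let $\mathcal{J}(g,I_\alpha,I_\beta)$ be given by Gualtieri's correspondence: $$\mathcal{J}(g,I_\alpha,I_\beta)=\frac12\begin{pmatrix}-(I_\alpha+I_\beta)&-(\omega_\alpha^{-1}-\omega_\beta^{-1})\\ \omega_\alpha-\omega_\beta&I_\alpha^*+I_\beta^*\end{pmatrix}.$$ Then every $\mathcal{J}(g,I_\alpha,I_\beta)$ is a generalized complex structure, and the following $\mathbb{CP}^1\times\mathbb{CP}^1$-families of generalized complex structures are the same family (the spinor families after interchanging the two factors of $\mathbb{CP}^1\times\mathbb{CP}^1$): 1. (Hyperkähler rotation.) For $\eta\in\mathbb{C}$ put $\sigma'_\eta=(\sigma-2\eta\omega_I-\eta^2\bar\sigma)/(1+|\eta|^2)$,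 and for $\zeta\in\mathbb{CP}^1$ put $$\mathcal{J}_{\eta,\zeta}=\tfrac{1-|\zeta|^2}{1+|\zeta|^2}\mathcal{J}_{I_\eta}+\tfrac{2\mathrm{Re}\,\zeta}{1+|\zeta|^2}\mathcal{J}_{\mathrm{Re}\,\sigma'_\eta}+\tfrac{2\mathrm{Im}\,\zeta}{1+|\zeta|^2}\mathcal{J}_{\mathrm{Im}\,\sigma'_\eta}$$ (with coefficients $-1,0,0$ at $\zeta=\infty$). Let $f(\eta,\zeta)=\left(\frac{\zeta+\eta}{-\bar\eta\zeta+1},\frac{-\zeta+\eta}{\bar\eta\zeta+1}\right)$. Then $f:\mathbb{C}\times\mathbb{CP}^1\to\mathbb{CP}^1\times\mathbb{CP}^1$ is surjective, and $\mathcal{J}_{\eta,\zeta}=\mathcal{J}(g,I_\alpha,I_\beta)$ whenever $(\alpha,\beta)=f(\eta,\zeta)$. Moreover, for all $\alpha,\beta\in\mathbb{CP}^1$ there is exactly one generalized complex structure with pure spinor $$\Phi_{\alpha,\beta}=i^n(\alpha-\beta)^n\exp\left(\frac{\sigma-(\alpha+\beta)\omega_I-\alpha\beta\bar\sigma}{i(\alpha-\beta)}\right),\qquad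 \Phi_{\alpha,\alpha}=\frac1{n!}(\sigma-2\alpha\omega_I-\alpha^2\bar\sigma)^n,$$ namely $\mathcal{J}(g,I_\beta,I_\alpha)$. Here, for $\alpha=a_0/a_1$ and $\beta=b_0/b_1$ in homogeneous coordinates, $\Phi_{\alpha,\beta}$ is multiplied by $(a_1b_1)^n$ (up to a nonzero constant on the diagonal), so that it makes sense also when $\alpha$ or $\beta$ is $\infty$. 2. (Isotropic spinors, $n=1$.) Let $\mathrm{vol}=\omega_I^2/2$ and $W=\langle\omega_I,\omega_J,\omega_K,1-\mathrm{vol}\rangle$. At each point of $M$, an element $X\omega_I+Y\omega_J+Z\omega_K+U(1-\mathrm{vol})\neq0$ of $W\otimes\mathbb{C}$ is isotropic for the Mukai pairing $(\varphi,\psi)=\varphi_2\wedge\psi_2-\varphi_0\wedge\psi_4-\varphi_4\wedge\psi_0$ if and only if $[X:Y:Z:U]=[-(\alpha+\beta):1-\alpha\beta:i(1+\alpha\beta):i(\alpha-\beta)]$ for some $(\alpha,\beta)\in\mathbb{CP}^1\times\mathbb{CP}^1$, and then $(\alpha,\beta)$ is unique. For all $\alpha,\beta$ there is exactly one generalized complex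 structure whose pure spinor is the element of $W\otimes\mathbb{C}$ with these coefficients (in homogeneous coordinates), namely $\mathcal{J}(g,I_\beta,I_\alpha)$. -/

import Mathlib

open Bundle VectorField Manifold
open scoped ContDiff ComplexConjugate LinearAlgebra.Projectivization

noncomputable section

namespace GenTwistor

/-! ### The complex projective line -/

/-- The complex projective line; the affine coordinate of `[a₀ : a₁]` is `a₀ / a₁`,
so that `∞ = [1 : 0]`. -/
abbrev CP1 : Type := ℙ ℂ (Fin 2 → ℂ)

/-- Inverse stereographic projection in homogeneous coordinates. For `a = (η, 1)` this is
`((1 - |η|²) / (1 + |η|²), 2 Re η / (1 + |η|²), 2 Im η / (1 + |η|²))`. -/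
def stereo (a : Fin 2 → ℂ) : Fin 3 → ℝ :=
  (Complex.normSq (a 0) + Complex.normSq (a 1))⁻¹ •
    ![Complex.normSq (a 1) - Complex.normSq (a 0),
      2 * (a 0 * conj (a 1)).re, 2 * (a 0 * conj (a 1)).im]

theorem stereo_smul (t : ℂ) (ht : t ≠ 0) (a : Fin 2 → ℂ) : stereo (t • a) = stereo a := by
  have h : Complex.normSq t ≠ 0 := by simpa using ht
  have e : (t • a) 0 * conj ((t • a) 1) = (Complex.normSq t : ℂ) * (a 0 * conj (a 1)) := by
    simp only [Pi.smul_apply, smul_eq_mul, map_mul, Complex.normSq_eq_conj_mul_self]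
    ring
  have e0 : Complex.normSq ((t • a) 0) + Complex.normSq ((t • a) 1)
      = Complex.normSq t * (Complex.normSq (a 0) + Complex.normSq (a 1)) := by
    simp; ring
  unfold stereo
  rw [e, e0, Complex.re_ofReal_mul, Complex.im_ofReal_mul, mul_inv]
  funext i
  fin_cases i <;> simp <;> field_simp

/-- The identification of `CP1` with the unit sphere `S² ⊂ ℝ³`. -/
def spherePoint : CP1 → Fin 3 → ℝ :=
  Projectivization.lift (fun a => stereo a.1) (by
    intro a b t h
    have ht : t ≠ 0 := by
      rintro rfl
      exact a.2 (by simpa using h)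
    simp only [h]
    exact stereo_smul t ht b.1)

theorem rot_injective (s : ℂ) (hs : s * s = 1) (η : ℂ) :
    Function.Injective (!![s, η; -(s * conj η), 1] : Matrix (Fin 2) (Fin 2) ℂ).mulVecLin := by
  have h : (!![s, η; -(s * conj η), 1] : Matrix (Fin 2) (Fin 2) ℂ).det ≠ 0 := by
    have e : (!![s, η; -(s * conj η), 1] : Matrix (Fin 2) (Fin 2) ℂ).det
        = s * ((1 + Complex.normSq η : ℝ) : ℂ) := by
      rw [Matrix.det_fin_two_of]
      push_cast
      rw [Complex.normSq_eq_conj_mul_self]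
      ring
    rw [e]
    refine mul_ne_zero (fun h => by simp [h] at hs) ?_
    have := Complex.normSq_nonneg η
    exact_mod_cast (by positivity : (1 + Complex.normSq η) ≠ 0)
  exact Matrix.mulVec_injective_iff_isUnit.2 ((Matrix.isUnit_iff_isUnit_det _).2 h.isUnit)

/-- The map `(η, ζ) ↦ ((ζ + η) / (-η̄ ζ + 1), (-ζ + η) / (η̄ ζ + 1))`, with `ζ ∈ CP1`. -/
def rotationMap (η : ℂ) (ζ : CP1) : CP1 × CP1 :=
  (Projectivization.map (!![1, η; -(1 * conj η), 1] : Matrix (Fin 2) (Fin 2) ℂ).mulVecLin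
      (rot_injective 1 (by norm_num) η) ζ,
    Projectivization.map (!![-1, η; -(-1 * conj η), 1] : Matrix (Fin 2) (Fin 2) ℂ).mulVecLin
      (rot_injective (-1) (by norm_num) η) ζ)

/-! ### Linear algebra of `V ⊕ V*` and of complex forms on a real vector space `V` -/

section Linear

variable {V : Type*} [AddCommGroup V] [Module ℝ V] [TopologicalSpace V]
  [IsTopologicalAddGroup V] [ContinuousSMul ℝ V]

/-- The pairing `⟨X + ξ, Y + η⟩ = (ξ(Y) + η(X)) / 2` on `V ⊕ V*`. -/
def pairing (u v : V × (V →L[ℝ] ℝ)) : ℝ := (1 / 2) * (u.2 v.1 + v.2 u.1)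

/-- The endomorphism of `V ⊕ V*` with block matrix `(A, P; Q, D)`. -/
def block (A : V →L[ℝ] V) (P : (V →L[ℝ] ℝ) →L[ℝ] V) (Q : V →L[ℝ] (V →L[ℝ] ℝ))
    (D : (V →L[ℝ] ℝ) →L[ℝ] (V →L[ℝ] ℝ)) :
    (V × (V →L[ℝ] ℝ)) →ₗ[ℝ] (V × (V →L[ℝ] ℝ)) :=
  LinearMap.prod
    ((A : V →ₗ[ℝ] V) ∘ₗ LinearMap.fst ℝ V (V →L[ℝ] ℝ) +
      (P : (V →L[ℝ] ℝ) →ₗ[ℝ] V) ∘ₗ LinearMap.snd ℝ V (V →L[ℝ] ℝ))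
    ((Q : V →ₗ[ℝ] (V →L[ℝ] ℝ)) ∘ₗ LinearMap.fst ℝ V (V →L[ℝ] ℝ) +
      (D : (V →L[ℝ] ℝ) →ₗ[ℝ] (V →L[ℝ] ℝ)) ∘ₗ LinearMap.snd ℝ V (V →L[ℝ] ℝ))

/-- The transpose `A* ξ = ξ ∘ A`. -/
def transpose (A : V →L[ℝ] V) : (V →L[ℝ] ℝ) →L[ℝ] (V →L[ℝ] ℝ) :=
  ContinuousLinearMap.precomp ℝ A

/-- `𝒥_I = (-I, 0; 0, I*)`. -/
def genOfComplex (I : V →L[ℝ] V) : (V × (V →L[ℝ] ℝ)) →ₗ[ℝ] (V × (V →L[ℝ] ℝ)) :=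
  block (-I) 0 0 (transpose I)

/-- `𝒥_w = (0, -w⁻¹; w, 0)`, where `w` is the map `X ↦ ι_X w`. -/
def genOfSymplectic (w : V →L[ℝ] (V →L[ℝ] ℝ)) :
    (V × (V →L[ℝ] ℝ)) →ₗ[ℝ] (V × (V →L[ℝ] ℝ)) :=
  block 0 (-w.inverse) w 0

/-- Gualtieri's endomorphism `𝒥` of `V ⊕ V*` attached to an inner product `g` and a pair of
complex structures `I₊, I₋`, with `ω± = g(I± ·, ·)`:
`𝒥 = ½ (-(I₊ + I₋), -(ω₊⁻¹ - ω₋⁻¹); ω₊ - ω₋, I₊* + I₋*)`. -/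
def gualtieri (g : V →L[ℝ] (V →L[ℝ] ℝ)) (Ip Im : V →L[ℝ] V) :
    (V × (V →L[ℝ] ℝ)) →ₗ[ℝ] (V × (V →L[ℝ] ℝ)) :=
  (1 / 2 : ℝ) • block (-(Ip + Im)) (-((g.comp Ip).inverse - (g.comp Im).inverse))
    (g.comp Ip - g.comp Im) (transpose Ip + transpose Im)

variable (V) in
/-- Complex forms `⋀ (V* ⊗ ℂ)`, where `V* ⊗ ℂ` is the space of real-linear maps `V → ℂ`. -/
abbrev Forms : Type _ := ExteriorAlgebra ℂ (V →ₗ[ℝ] ℂ)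

/-- A real covector, seen in `V* ⊗ ℂ`. -/
def toComplex (ξ : V →L[ℝ] ℝ) : V →ₗ[ℝ] ℂ :=
  Complex.ofRealCLM.toLinearMap ∘ₗ (ξ : V →ₗ[ℝ] ℝ)

/-- Evaluation at a vector, as a functional on `V* ⊗ ℂ`. -/
def evalAt (X : V) : Module.Dual ℂ (V →ₗ[ℝ] ℂ) where
  toFun φ := φ X
  map_add' _ _ := rfl
  map_smul' _ _ := rfl

/-- The action of `V ⊕ V*` on forms: `(X + ξ) · φ = ι_X φ + ξ ∧ φ`. -/
def cliffordAct (u : V × (V →L[ℝ] ℝ)) (φ : Forms V) : Forms V :=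
  CliffordAlgebra.contractLeft (evalAt u.1) φ + ExteriorAlgebra.ι ℂ (toComplex u.2) * φ

/-- An element `u + i v` of `(V ⊕ V*) ⊗ ℂ` lies in the `+i`-eigenspace of `𝒥`. -/
def InEigen (𝒥 : (V × (V →L[ℝ] ℝ)) →ₗ[ℝ] (V × (V →L[ℝ] ℝ)))
    (u v : V × (V →L[ℝ] ℝ)) : Prop :=
  𝒥 u = -v ∧ 𝒥 v = u

/-- `φ` is a pure spinor for `𝒥`: it is nonzero, and its annihilator in `(V ⊕ V*) ⊗ ℂ` is
precisely the `+i`-eigenspace of `𝒥`. -/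
def IsPureSpinor (𝒥 : (V × (V →L[ℝ] ℝ)) →ₗ[ℝ] (V × (V →L[ℝ] ℝ))) (φ : Forms V) : Prop :=
  φ ≠ 0 ∧ ∀ u v : V × (V →L[ℝ] ℝ),
    cliffordAct u φ + Complex.I • cliffordAct v φ = 0 ↔ InEigen 𝒥 u v

/-- The two-form with contraction `ι_X = w X`, as an element of the exterior algebra:
`½ ∑ᵢ eⁱ ∧ ι_{eᵢ} w` for a basis `(eᵢ)` of `V`. -/
def twoForm [FiniteDimensional ℝ V] (w : V →L[ℝ] (V →L[ℝ] ℝ)) : Forms V :=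
  (1 / 2 : ℂ) • ∑ i, ExteriorAlgebra.ι ℂ
      (Complex.ofRealCLM.toLinearMap ∘ₗ (Module.finBasis ℝ V).coord i) *
    ExteriorAlgebra.ι ℂ (toComplex (w (Module.finBasis ℝ V i)))

/-- The Mukai pairing of even forms on a four-dimensional space, with values in four-forms:
`(φ, ψ) = φ₂ ∧ ψ₂ - φ₀ ∧ ψ₄ - φ₄ ∧ ψ₀`. -/
def mukai (φ ψ : Forms V) : Forms V :=
  let p : ℕ → Forms V → Forms V := fun k => GradedRing.proj (fun i : ℕ => ⋀[ℂ]^i (V →ₗ[ℝ] ℂ)) k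
  p 2 φ * p 2 ψ - p 0 φ * p 4 ψ - p 4 φ * p 0 ψ

end Linear

/-! ### Manifolds -/

/-- The model space of a manifold of real dimension `4n`. -/
abbrev Model (n : ℕ) : Type := EuclideanSpace ℝ (Fin (4 * n))

/-- `𝕋 n` is the tangent bundle of a manifold modelled on `Model n`. -/
local notation:max "𝕋" n:max => TangentSpace (modelWithCornersSelf ℝ (Model n))

section Manifold

variable {n : ℕ} {M : Type*} [TopologicalSpace M] [ChartedSpace (Model n) M]
  [IsManifold 𝓘(ℝ, Model n) ∞ M]

instance (x : M) : FiniteDimensional ℝ (𝕋 n x) :=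
  inferInstanceAs (FiniteDimensional ℝ (Model n))

/-- Smooth vector fields. -/
def SmoothVF (X : ∀ x : M, 𝕋 n x) : Prop :=
  ContMDiff 𝓘(ℝ, Model n) (𝓘(ℝ, Model n).prod 𝓘(ℝ, Model n)) ∞
    (fun x => TotalSpace.mk' (Model n) x (X x))

/-- Smooth one-forms. -/
def SmoothOneForm (ξ : ∀ x : M, 𝕋 n x →L[ℝ] ℝ) : Prop :=
  ContMDiff 𝓘(ℝ, Model n) (𝓘(ℝ, Model n).prod 𝓘(ℝ, Model n →L[ℝ] ℝ)) ∞
    (fun x => TotalSpace.mk' (Model n →L[ℝ] ℝ) x (ξ x))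

/-- Smooth fields of endomorphisms of the tangent bundle. -/
def SmoothEnd (A : ∀ x : M, 𝕋 n x →L[ℝ] 𝕋 n x) : Prop :=
  ContMDiff 𝓘(ℝ, Model n) (𝓘(ℝ, Model n).prod 𝓘(ℝ, Model n →L[ℝ] Model n)) ∞
    (fun x => TotalSpace.mk' (Model n →L[ℝ] Model n) x (A x))

/-- The derivative of a function along a vector field. -/
def along (X : ∀ x : M, 𝕋 n x) (f : M → ℝ) (x : M) : ℝ :=
  mvfderiv 𝓘(ℝ, Model n) f x (X x)

/-- The Lie bracket of vector fields. -/
def lie (X Y : ∀ x : M, 𝕋 n x) : ∀ x : M, 𝕋 n x := mlieBracket 𝓘(ℝ, Model n) X Y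

/-- Smooth sections `X + ξ` of `T ⊕ T*`. -/
structure GenSection (n : ℕ) (M : Type*) [TopologicalSpace M] [ChartedSpace (Model n) M]
    [IsManifold 𝓘(ℝ, Model n) ∞ M] where
  vec : ∀ x : M, 𝕋 n x
  form : ∀ x : M, 𝕋 n x →L[ℝ] ℝ
  smooth_vec : SmoothVF vec
  smooth_form : SmoothOneForm form

/-- The value on a vector field `Z` of the one-form `L_X η - ι_Y dξ`, that is
`X(η(Z)) - η([X, Z]) - (Y(ξ(Z)) - Z(ξ(Y)) - ξ([Y, Z]))`. -/
def dorfmanEval (e f : GenSection n M) (x : M) (Z : ∀ x : M, 𝕋 n x) : ℝ :=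
  along e.vec (fun y => f.form y (Z y)) x - f.form x (lie e.vec Z x) -
    (along f.vec (fun y => e.form y (Z y)) x - along Z (fun y => e.form y (f.vec y)) x -
      e.form x (lie f.vec Z x))

theorem mdiff_pair (ξ : ∀ x : M, 𝕋 n x →L[ℝ] ℝ) (hξ : SmoothOneForm ξ) (Z : ∀ x : M, 𝕋 n x)
    (x : M) (hZ : MDifferentiableAt 𝓘(ℝ, Model n) (𝓘(ℝ, Model n).prod 𝓘(ℝ, Model n))
      (fun y => TotalSpace.mk' (Model n) y (Z y)) x) :
    MDifferentiableAt 𝓘(ℝ, Model n) 𝓘(ℝ, ℝ) (fun y => ξ y (Z y)) x := by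
  have h1 := (hξ x).mdifferentiableAt (by simp)
  have := MDifferentiableAt.clm_bundle_apply (F₁ := Model n) (F₂ := ℝ) (E₁ := 𝕋 n)
    (E₂ := Bundle.Trivial M ℝ) (b := fun y : M => y) (ϕ := ξ) (v := Z) h1 hZ
  simp only [mdifferentiableAt_totalSpace] at this
  exact this.2

theorem dorfman_tensorial (e f : GenSection n M) (x : M) :
    TensorialAt 𝓘(ℝ, Model n) (Model n) (dorfmanEval e f x) x where
  smul := by
    intro c Z hc hZ
    have he := (e.smooth_vec x).mdifferentiableAt (by simp)
    have hf := (f.smooth_vec x).mdifferentiableAt (by simp)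
    have k1 := mdiff_pair f.form f.smooth_form Z x hZ
    have k2 := mdiff_pair e.form e.smooth_form Z x hZ
    simp only [dorfmanEval, lie]
    rw [mlieBracket_smul_right hc hZ, mlieBracket_smul_right hc hZ]
    simp only [along]
    have l1 : (fun y => f.form y ((c • Z) y)) = c * (fun y => f.form y (Z y)) := by
      ext y; simp
    have l2 : (fun y => e.form y ((c • Z) y)) = c * (fun y => e.form y (Z y)) := by
      ext y; simp
    rw [l1, l2, mvfderiv_mul hc k1, mvfderiv_mul hc k2]
    simp
    ring
  add := by
    intro Z W hZ hW
    have k1 := mdiff_pair f.form f.smooth_form Z x hZ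
    have k2 := mdiff_pair e.form e.smooth_form Z x hZ
    have k3 := mdiff_pair f.form f.smooth_form W x hW
    have k4 := mdiff_pair e.form e.smooth_form W x hW
    simp only [dorfmanEval, lie]
    rw [mlieBracket_add_right hZ hW, mlieBracket_add_right hZ hW]
    simp only [along]
    have l1 : (fun y => f.form y ((Z + W) y)) =
      (fun y => f.form y (Z y)) + (fun y => f.form y (W y)) := by
      ext y; simp
    have l2 : (fun y => e.form y ((Z + W) y)) =
      (fun y => e.form y (Z y)) + (fun y => e.form y (W y)) := by
      ext y; simp
    rw [l1, l2, mvfderiv_add k1 k3, mvfderiv_add k2 k4]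
    simp
    ring

/-- The Dorfman bracket `[X + ξ, Y + η] = [X, Y] + L_X η - ι_Y dξ`. -/
def dorfman (e f : GenSection n M) (x : M) : 𝕋 n x × (𝕋 n x →L[ℝ] ℝ) :=
  (lie e.vec f.vec x, TensorialAt.mkHom (dorfmanEval e f x) x (dorfman_tensorial e f x))

/-- Fields of endomorphisms of `T ⊕ T*`. -/
abbrev GenEnd (n : ℕ) (M : Type*) [TopologicalSpace M] [ChartedSpace (Model n) M] : Type _ :=
  ∀ x : M, (𝕋 n x × (𝕋 n x →L[ℝ] ℝ)) →ₗ[ℝ] (𝕋 n x × (𝕋 n x →L[ℝ] ℝ))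

/-- The value of a section at a point. -/
def GenSection.at (e : GenSection n M) (x : M) : 𝕋 n x × (𝕋 n x →L[ℝ] ℝ) := (e.vec x, e.form x)

/-- Generalized complex structures: smooth orthogonal endomorphisms `𝒥` of `T ⊕ T*` with `𝒥² = -1`,
whose `+i`-eigenbundle in `(T ⊕ T*) ⊗ ℂ` is involutive. Complex sections are written
`s + i s'` with real `s, s'`, and the bracket is extended complex bilinearly. -/
structure IsGenComplex (𝒥 : GenEnd n M) : Prop where
  smooth : ∀ e : GenSection n M,
    SmoothVF (fun x => (𝒥 x (e.at x)).1) ∧ SmoothOneForm (fun x => (𝒥 x (e.at x)).2)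
  orthogonal : ∀ x u v, pairing (𝒥 x u) (𝒥 x v) = pairing u v
  sq : ∀ x u, 𝒥 x (𝒥 x u) = -u
  involutive : ∀ s s' t t' : GenSection n M,
    (∀ x, InEigen (𝒥 x) (s.at x) (s'.at x)) → (∀ x, InEigen (𝒥 x) (t.at x) (t'.at x)) →
      ∀ x, InEigen (𝒥 x) (dorfman s t x - dorfman s' t' x) (dorfman s t' x + dorfman s' t x)

/-- Vector fields that are smooth near a point. -/
def SmoothVFAt (X : ∀ x : M, 𝕋 n x) (x : M) : Prop :=
  ContMDiffAt 𝓘(ℝ, Model n) (𝓘(ℝ, Model n).prod 𝓘(ℝ, Model n)) ∞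
    (fun y => TotalSpace.mk' (Model n) y (X y)) x

/-- `dw = 0`, for a two-form `w`, by the formula for `dw(X, Y, Z)`. -/
def IsClosedTwoForm (w : ∀ x : M, 𝕋 n x →L[ℝ] (𝕋 n x →L[ℝ] ℝ)) : Prop :=
  ∀ (x : M) (X Y Z : ∀ x : M, 𝕋 n x), SmoothVFAt X x → SmoothVFAt Y x → SmoothVFAt Z x →
    along X (fun y => w y (Y y) (Z y)) x - along Y (fun y => w y (X y) (Z y)) x +
      along Z (fun y => w y (X y) (Y y)) x - w x (lie X Y x) (Z x) + w x (lie X Z x) (Y x) -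
      w x (lie Y Z x) (X x) = 0

/-- Vanishing of the Nijenhuis tensor. -/
def IsIntegrable (A : ∀ x : M, 𝕋 n x →L[ℝ] 𝕋 n x) : Prop :=
  ∀ (x : M) (X Y : ∀ x : M, 𝕋 n x), SmoothVFAt X x → SmoothVFAt Y x →
    lie (fun y => A y (X y)) (fun y => A y (Y y)) x - A x (lie (fun y => A y (X y)) Y x) -
      A x (lie X (fun y => A y (Y y)) x) - lie X Y x = 0

/-- Smooth Riemannian metrics. -/
abbrev Metric (n : ℕ) (M : Type*) [TopologicalSpace M] [ChartedSpace (Model n) M]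
    [IsManifold 𝓘(ℝ, Model n) ∞ M] : Type _ :=
  ContMDiffRiemannianMetric 𝓘(ℝ, Model n) ∞ (Model n) (𝕋 n : M → Type)

/-- The metric `g` is Kählerian with respect to the complex structure `A`;
the Kähler form is `g(A ·, ·)`. -/
structure IsKahler (g : Metric n M) (A : ∀ x : M, 𝕋 n x →L[ℝ] 𝕋 n x) : Prop where
  smooth : SmoothEnd A
  sq : ∀ x u, A x (A x u) = -u
  integrable : IsIntegrable A
  hermitian : ∀ x u v, g.inner x (A x u) (A x v) = g.inner x u v
  closed : IsClosedTwoForm (fun x => (g.inner x).comp (A x))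

end Manifold

/-- Hyperkähler structures on a manifold of real dimension `4n`. -/
structure Hyperkahler (n : ℕ) (M : Type*) [TopologicalSpace M] [ChartedSpace (Model n) M]
    [IsManifold 𝓘(ℝ, Model n) ∞ M] where
  g : Metric n M
  I : ∀ x : M, 𝕋 n x →L[ℝ] 𝕋 n x
  J : ∀ x : M, 𝕋 n x →L[ℝ] 𝕋 n x
  K : ∀ x : M, 𝕋 n x →L[ℝ] 𝕋 n x
  kahler_I : IsKahler g I
  kahler_J : IsKahler g J
  kahler_K : IsKahler g K
  IJ : ∀ x u, I x (J x u) = K x u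
  JI : ∀ x u, J x (I x u) = -K x u
  JK : ∀ x u, J x (K x u) = I x u
  KJ : ∀ x u, K x (J x u) = -I x u
  KI : ∀ x u, K x (I x u) = J x u
  IK : ∀ x u, I x (K x u) = -J x u

namespace Hyperkahler

variable {n : ℕ} {M : Type*} [TopologicalSpace M] [ChartedSpace (Model n) M]
  [IsManifold 𝓘(ℝ, Model n) ∞ M] (H : Hyperkahler n M)

/-- `c₀ I + c₁ J + c₂ K`. -/
def cplx (c : Fin 3 → ℝ) (x : M) : 𝕋 n x →L[ℝ] 𝕋 n x := c 0 • H.I x + c 1 • H.J x + c 2 • H.K x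

/-- `c₀ ω_I + c₁ ω_J + c₂ ω_K`, as a map `T → T*`. -/
def kahler (c : Fin 3 → ℝ) (x : M) : 𝕋 n x →L[ℝ] (𝕋 n x →L[ℝ] ℝ) := (H.g.inner x).comp (H.cplx c x)

/-- The form `ω_I`. -/
def omegaI (x : M) : Forms (𝕋 n x) := twoForm (H.kahler ![1, 0, 0] x)

/-- The form `ω_J`. -/
def omegaJ (x : M) : Forms (𝕋 n x) := twoForm (H.kahler ![0, 1, 0] x)

/-- The form `ω_K`. -/
def omegaK (x : M) : Forms (𝕋 n x) := twoForm (H.kahler ![0, 0, 1] x)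

/-- `σ = ω_J + i ω_K`. -/
def sigma (x : M) : Forms (𝕋 n x) := H.omegaJ x + Complex.I • H.omegaK x

/-- `σ̄ = ω_J - i ω_K`. -/
def sigmaBar (x : M) : Forms (𝕋 n x) := H.omegaJ x - Complex.I • H.omegaK x

/-- The generalized complex structure given by the bi-Hermitian structure `(g, I_α, I_β)`. -/
def biHermitian (α β : CP1) : GenEnd n M := fun x =>
  gualtieri (H.g.inner x) (H.cplx (spherePoint α) x) (H.cplx (spherePoint β) x)

/-- The coefficients of `σ'_η = (σ - 2 η ω_I - η² σ̄) / (1 + |η|²)` along `ω_I, ω_J, ω_K`. -/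
def sigmaPrimeCoeff (η : ℂ) : Fin 3 → ℂ :=
  (1 + Complex.normSq η : ℂ)⁻¹ • ![-2 * η, 1 - η ^ 2, Complex.I * (1 + η ^ 2)]

/-- Hyperkähler rotation: with `(z₀, z₁, z₂)` the point of the unit sphere given by `ζ`,
`𝒥_{η,ζ} = z₀ 𝒥_{I_η} + z₁ 𝒥_{Re σ'_η} + z₂ 𝒥_{Im σ'_η}`. -/
def rotation (η : ℂ) (ζ : CP1) : GenEnd n M := fun x =>
  spherePoint ζ 0 • genOfComplex (H.cplx (stereo ![η, 1]) x) +
    spherePoint ζ 1 • genOfSymplectic (H.kahler (fun i => (sigmaPrimeCoeff η i).re) x) +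
    spherePoint ζ 2 • genOfSymplectic (H.kahler (fun i => (sigmaPrimeCoeff η i).im) x)

/-- The spinor `Φ_{α,β} = iⁿ (α - β)ⁿ exp ((σ - (α + β) ω_I - α β σ̄) / (i (α - β)))` in homogeneous
coordinates `α = a₀ / a₁`, `β = b₀ / b₁` (multiplied by `(a₁ b₁)ⁿ`); on the diagonal, where the
formula is extended holomorphically, it is `(1 / n!) (σ - (α + β) ω_I - α β σ̄)ⁿ`. -/
def rotationSpinor (a b : Fin 2 → ℂ) (x : M) : Forms (𝕋 n x) :=
  let δ : ℂ := a 0 * b 1 - a 1 * b 0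
  let θ : Forms (𝕋 n x) := (a 1 * b 1) • H.sigma x - (a 0 * b 1 + a 1 * b 0) • H.omegaI x -
    (a 0 * b 0) • H.sigmaBar x
  if δ = 0 then (n.factorial : ℂ)⁻¹ • θ ^ n
  else (Complex.I * δ) ^ n • IsNilpotent.exp ((Complex.I * δ)⁻¹ • θ)

/-- For `c = (X, Y, Z, U)`, the element `X ω_I + Y ω_J + Z ω_K + U (1 - vol)` of `W ⊗ ℂ`,
where `vol = ω_I² / 2`. -/
def mukaiElement (c : Fin 4 → ℂ) (x : M) : Forms (𝕋 n x) :=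
  c 0 • H.omegaI x + c 1 • H.omegaJ x + c 2 • H.omegaK x +
    c 3 • (1 - (1 / 2 : ℂ) • (H.omegaI x) ^ 2)

end Hyperkahler

/-- The point `(X, Y, Z, U) = (-(α + β), 1 - α β, i (1 + α β), i (α - β))` of the quadric
`X² + Y² + Z² + U² = 0`, in homogeneous coordinates `α = a₀ / a₁`, `β = b₀ / b₁`. -/
def quadricPoint (a b : Fin 2 → ℂ) : Fin 4 → ℂ :=
  ![-(a 0 * b 1 + a 1 * b 0), a 1 * b 1 - a 0 * b 0, Complex.I * (a 1 * b 1 + a 0 * b 0),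
    Complex.I * (a 0 * b 1 - a 1 * b 0)]

end GenTwistor
end
open GenTwistor

noncomputable section

set_option linter.unusedSectionVars false

namespace GenTwistor

open scoped Quaternion

local notation:max "𝕋" n:max => TangentSpace (modelWithCornersSelf ℝ (Model n))

/-! ### Bivectors, their powers and exponentials in the exterior algebra. -/

section Exterior

open Module

variable {K E : Type*} [Field K] [AddCommGroup E] [Module K E]

/-! Apart from smoothness and involutivity, the statements about structures and spinors are linear
algebra at a point. The metric identifies complex vectors with complex covectors, and the
complexified quaternions, a matrix algebra `M₂(ℂ)`, act on the latter. Write an element of `(V ⊕ V*)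
⊗ ℂ` as `X + g(Y)`, and put `f = g(X)`, `k = g(Y)`. Then `𝒥(g, I_β, I_α)` acts as `-I_α` on `X + Y`
and as `-I_β` on `X - Y`, so its `+i`-eigenspace is given by `(I_α + i)(f + k) = 0` and `(I_β + i)(f
- k) = 0`.

Let `D = i (a₀ b₁ - a₁ b₀)` and let `θ` be the imaginary quaternion with the coefficients of `a₁ b₁
σ - (a₀ b₁ + a₁ b₀) ω_I - a₀ b₀ σ̄`. Since `θ² = D²`, the elements `D ± θ` are zero divisors;
precisely, `(I_α + i)(D - θ) = 0 = (D + θ)(I_α - i)`, and likewise for `β` with the sign of `θ`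
changed. If `D ≠ 0`, these identities reduce the two equations to `D k = -θ f`: the eigenspace is
the graph of `-θ / D`, which is the annihilator of `exp (θ / D)` (`IsBivector.annihilator_exp`). If
`D = 0`, then `ker (I_α + i) = ker θ = im θ` has half the full dimension, and the eigenspace `θ f =
θ k = 0` is the annihilator of `θⁿ`, the last nonzero power of a bivector of rank `2n`
(`IsBivector.annihilator_pow`). As an annihilator determines the structure, uniqueness follows.

Involutivity comes from closedness of the Kähler forms: off the diagonal the eigenbundle is the
graph of a closed complex two-form; on it, the `(0, 1)` vectors are the kernel of a closed form, and
the `(1, 0)` covectors are their annihilator.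

For the rotation family, `(1, η; -η̄, 1)` is a multiple of a matrix in `SU(2)` and rotates the axes
`I, J, K` to `I_η`, `Re σ'_η`, `Im σ'_η`. Replacing `ζ` by `-ζ` changes the sign of the last two
coordinates, so half the sum of the two complex structures is the `I_η` part and half the difference
is the rest. Surjectivity amounts to finding a midpoint of two points of the sphere. For `n = 1` the
exponential series stops in degree four, and the quadric is parametrised by the Segre map. -/

/-- The span of the products of two vectors in the exterior algebra. -/
def twoVectors (K E : Type*) [Field K] [AddCommGroup E] [Module K E] :
    Submodule K (ExteriorAlgebra K E) :=
  Submodule.span K {x | ∃ a b : E, x = ExteriorAlgebra.ι K a * ExteriorAlgebra.ι K b}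

/-- `θ` is a bivector whose contractions are given by the linear map `B`. -/
structure IsBivector (θ : ExteriorAlgebra K E) (B : Dual K E →ₗ[K] E) : Prop where
  mem : θ ∈ twoVectors K E
  contract : ∀ d, CliffordAlgebra.contractLeft d θ = ExteriorAlgebra.ι K (B d)

theorem contractLeft_ι_mul' (d : Dual K E) (a : E) (x : ExteriorAlgebra K E) :
    CliffordAlgebra.contractLeft d (ExteriorAlgebra.ι K a * x) =
      d a • x - ExteriorAlgebra.ι K a * CliffordAlgebra.contractLeft d x :=
  CliffordAlgebra.contractLeft_ι_mul _ _ _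

theorem contractLeft_ι' (d : Dual K E) (a : E) :
    CliffordAlgebra.contractLeft d (ExteriorAlgebra.ι K a) =
      algebraMap K (ExteriorAlgebra K E) (d a) :=
  CliffordAlgebra.contractLeft_ι _ _ _

theorem contractLeft_one' (d : Dual K E) :
    CliffordAlgebra.contractLeft d (1 : ExteriorAlgebra K E) = 0 :=
  CliffordAlgebra.contractLeft_one _ _

theorem ι_mul_ι_comm (a b : E) :
    ExteriorAlgebra.ι K a * ExteriorAlgebra.ι K b =
      -(ExteriorAlgebra.ι K b * ExteriorAlgebra.ι K a) :=
  eq_neg_of_add_eq_zero_left (ExteriorAlgebra.ι_add_mul_swap a b)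

theorem contractLeft_ι_mul_ι (d : Dual K E) (a b : E) :
    CliffordAlgebra.contractLeft d (ExteriorAlgebra.ι K a * ExteriorAlgebra.ι K b) =
      ExteriorAlgebra.ι K (d a • b - d b • a) := by
  rw [contractLeft_ι_mul', contractLeft_ι', map_sub, map_smul, map_smul, ← Algebra.commutes,
    ← Algebra.smul_def]

/-- A generator anticommutes with each factor of a product of two vectors, so the two signs cancel:
elements of degree two are central. -/
theorem commute_of_mem_twoVectors {θ : ExteriorAlgebra K E} (h : θ ∈ twoVectors K E)
    (x : ExteriorAlgebra K E) : Commute θ x := by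
  induction x using CliffordAlgebra.left_induction with
  | algebraMap r => exact (Algebra.commutes r θ).symm
  | add x y hx hy => exact hx.add_right hy
  | ι_mul x c hx =>
    refine Commute.mul_right ?_ hx
    clear hx
    induction h using Submodule.span_induction with
    | mem x h =>
      obtain ⟨a, b, rfl⟩ := h
      change _ * ExteriorAlgebra.ι K c = ExteriorAlgebra.ι K c * _
      rw [mul_assoc, ι_mul_ι_comm b c, mul_neg, ← mul_assoc, ι_mul_ι_comm a c, neg_mul, neg_neg,
        mul_assoc]
    | zero => exact Commute.zero_left _
    | add y z _ _ hy hz => exact hy.add_left hz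
    | smul r y _ hy => exact hy.smul_left r

theorem contractLeft_mul_of_mem {θ : ExteriorAlgebra K E} (h : θ ∈ twoVectors K E)
    (d : Dual K E) (x : ExteriorAlgebra K E) :
    CliffordAlgebra.contractLeft d (θ * x) =
      CliffordAlgebra.contractLeft d θ * x + θ * CliffordAlgebra.contractLeft d x := by
  induction h using Submodule.span_induction with
  | mem y h =>
    obtain ⟨a, b, rfl⟩ := h
    rw [mul_assoc, contractLeft_ι_mul', contractLeft_ι_mul', contractLeft_ι_mul_ι, map_sub,
      map_smul, map_smul]
    simp only [sub_mul, mul_sub, smul_mul_assoc, mul_smul_comm, mul_assoc]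
    abel
  | zero => simp
  | add y z _ _ hy hz => rw [add_mul, map_add, hy, hz, map_add]; noncomm_ring
  | smul r y _ hy => rw [smul_mul_assoc, map_smul, hy, map_smul]; simp [smul_add]

/-- Euler's identity in degree two. Through it a bivector all of whose contractions vanish is itself
zero. -/
theorem twoVectors_euler [FiniteDimensional K E] {ι : Type*} [Fintype ι] (b : Basis ι K E)
    {θ : ExteriorAlgebra K E} (h : θ ∈ twoVectors K E) :
    ∑ i, ExteriorAlgebra.ι K (b i) * CliffordAlgebra.contractLeft (b.coord i) θ =
      (2 : K) • θ := by
  induction h using Submodule.span_induction with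
  | mem y h =>
    obtain ⟨u, v, rfl⟩ := h
    have hu := b.sum_repr u
    have hv := b.sum_repr v
    simp only [contractLeft_ι_mul_ι, map_sub, map_smul, mul_sub, Finset.sum_sub_distrib,
      mul_smul_comm, Basis.coord_apply]
    simp only [← smul_mul_assoc, ← map_smul, ← Finset.sum_mul, ← map_sum, hu, hv]
    rw [ι_mul_ι_comm v u, sub_neg_eq_add, two_smul]
    simp [add_mul]
  | zero => simp
  | add y z _ _ hy hz => simp only [map_add, mul_add, Finset.sum_add_distrib, hy, hz, smul_add]
  | smul r y _ hy =>
    simp only [map_smul, mul_smul_comm, ← Finset.smul_sum, hy]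
    rw [smul_comm]

namespace IsBivector

variable {θ θ' : ExteriorAlgebra K E} {B B' : Dual K E →ₗ[K] E}

theorem add (h : IsBivector θ B) (h' : IsBivector θ' B') : IsBivector (θ + θ') (B + B') :=
  ⟨add_mem h.mem h'.mem, fun d => by rw [map_add, h.contract, h'.contract, ← map_add]; rfl⟩

theorem smul (c : K) (h : IsBivector θ B) : IsBivector (c • θ) (c • B) :=
  ⟨Submodule.smul_mem _ c h.mem, fun d => by rw [map_smul, h.contract, ← map_smul]; rfl⟩

theorem sub (h : IsBivector θ B) (h' : IsBivector θ' B') : IsBivector (θ - θ') (B - B') :=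
  ⟨sub_mem h.mem h'.mem, fun d => by rw [map_sub, h.contract, h'.contract, ← map_sub]; rfl⟩

theorem apply_self (h : IsBivector θ B) (d : Dual K E) : d (B d) = 0 := by
  have := CliffordAlgebra.contractLeft_contractLeft d θ
  rw [h.contract, contractLeft_ι'] at this
  exact (algebraMap K (ExteriorAlgebra K E)).injective (by simpa using this)

theorem apply_swap (h : IsBivector θ B) (d d' : Dual K E) : d' (B d) = -d (B d') := by
  have := h.apply_self (d + d')
  simp only [map_add, LinearMap.add_apply, h.apply_self] at this
  linear_combination this

theorem contract_pow (h : IsBivector θ B) (d : Dual K E) (k : ℕ) :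
    CliffordAlgebra.contractLeft d (θ ^ (k + 1)) =
      ((k : K) + 1) • (ExteriorAlgebra.ι K (B d) * θ ^ k) := by
  induction k with
  | zero => simp [h.contract]
  | succ k ih =>
    rw [pow_succ' θ (k + 1), contractLeft_mul_of_mem h.mem, ih, h.contract, mul_smul_comm,
      ← mul_assoc, (commute_of_mem_twoVectors h.mem _).eq, mul_assoc, ← pow_succ']
    push_cast
    module

theorem contract_pow_of_eq_zero (h : IsBivector θ B) {d : Dual K E} (hd : B d = 0) (k : ℕ) :
    CliffordAlgebra.contractLeft d (θ ^ k) = 0 := by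
  cases k with
  | zero => simp
  | succ k => simp [h.contract_pow, hd]

/-- The power of a bivector vanishes if and only if the exponent exceeds half its rank. -/
theorem pow_eq_zero_iff [CharZero K] [FiniteDimensional K E] (h : IsBivector θ B) (k : ℕ) :
    θ ^ k = 0 ↔ finrank K (LinearMap.range B) < 2 * k := by
  induction k generalizing θ B with
  | zero => simp
  | succ k ih =>
    by_cases hB : B = 0
    · subst hB
      have : θ = 0 := by
        have := twoVectors_euler (Module.finBasis K E) h.mem
        simpa [h.contract] using this.symm
      subst this
      rw [LinearMap.range_zero, finrank_bot]
      simp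
    · obtain ⟨d₀, hd₀⟩ : ∃ d, B d ≠ 0 := by
        by_contra! hh
        exact hB (LinearMap.ext hh)
      obtain ⟨d₁, h₁⟩ : ∃ d : Dual K E, d (B d₀) = 1 := by
        obtain ⟨d, hd⟩ : ∃ d : Dual K E, d (B d₀) ≠ 0 := by
          by_contra! hh
          exact hd₀ ((forall_dual_apply_eq_zero_iff K _).1 hh)
        exact ⟨(d (B d₀))⁻¹ • d, by simp [hd]⟩
      set α := B d₀ with hα
      set β := B d₁ with hβ
      have h0α : d₀ α = 0 := h.apply_self d₀
      have h1β : d₁ β = 0 := h.apply_self d₁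
      have h0β : d₀ β = -1 := by rw [hβ, h.apply_swap, ← hα, h₁]
      -- Symplectic splitting: `τ = α ∧ β` has the same contractions with `d₀` and `d₁` as `θ`, so
      -- both functionals kill `θ - τ`, whose rank is smaller by two.
      set τ := ExteriorAlgebra.ι K α * ExteriorAlgebra.ι K β with hτ
      have hτ' : IsBivector τ ((Dual.eval K E α).smulRight β - (Dual.eval K E β).smulRight α) :=
        ⟨Submodule.subset_span ⟨α, β, rfl⟩, fun d => by simp [hτ, contractLeft_ι_mul_ι]⟩
      set B' := B - ((Dual.eval K E α).smulRight β - (Dual.eval K E β).smulRight α) with hB'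
      have h' : IsBivector (θ - τ) B' := h.sub hτ'
      have hB'd (d) : B' d = B d - (d α • β - d β • α) := by simp [hB']
      have e0 : B' d₀ = 0 := by rw [hB'd, h0α, h0β, ← hα]; simp
      have e1 : B' d₁ = 0 := by rw [hB'd, h₁, h1β, ← hβ]; simp
      have hrank : finrank K (LinearMap.range B) = finrank K (LinearMap.range B') + 2 := by
        have hsup : LinearMap.range B = LinearMap.range B' ⊔ Submodule.span K {α, β} := by
          apply le_antisymm
          · rintro _ ⟨d, rfl⟩
            rw [show B d = B' d + (d α • β - d β • α) by rw [hB'd]; abel]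
            refine Submodule.add_mem_sup ⟨d, rfl⟩ (sub_mem ?_ ?_) <;>
              exact Submodule.smul_mem _ _ (Submodule.subset_span (by simp))
          · refine sup_le ?_ ?_
            · rintro _ ⟨d, rfl⟩
              rw [hB'd]
              exact sub_mem ⟨d, rfl⟩ (sub_mem (Submodule.smul_mem _ _ ⟨d₁, rfl⟩)
                (Submodule.smul_mem _ _ ⟨d₀, rfl⟩))
            · rw [Submodule.span_le]
              rintro _ (rfl | rfl)
              exacts [⟨d₀, rfl⟩, ⟨d₁, rfl⟩]
        have hinf : LinearMap.range B' ⊓ Submodule.span K {α, β} = ⊥ := by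
          rw [eq_bot_iff]
          rintro _ ⟨⟨d, rfl⟩, hd⟩
          obtain ⟨x, y, hxy⟩ := Submodule.mem_span_pair.1 hd
          have k0 := h'.apply_swap d d₀
          have k1 := h'.apply_swap d d₁
          rw [e0, ← hxy] at k0
          rw [e1, ← hxy] at k1
          simp [h0α, h0β, h₁, h1β] at k0 k1
          rw [← hxy]; simp [k0, k1]
        have hind : finrank K (Submodule.span K {α, β}) = 2 := by
          have : LinearIndependent K ![α, β] := by
            rw [LinearIndependent.pair_iff]
            intro s t hst
            have k0 := congrArg d₀ hst
            have k1 := congrArg d₁ hst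
            simp [h0α, h0β, h₁, h1β] at k0 k1
            exact ⟨k1, k0⟩
          have := finrank_span_eq_card this
          rwa [Matrix.range_cons_cons_empty, Fintype.card_fin] at this
        have := Submodule.finrank_sup_add_finrank_inf_eq (LinearMap.range B')
          (Submodule.span K {α, β})
        rw [← hsup, hinf, finrank_bot, hind] at this
        omega
      have hcomm : Commute τ (θ - τ) := commute_of_mem_twoVectors hτ'.mem _
      have hττ : τ * τ = 0 := by
        rw [hτ, mul_assoc, ← mul_assoc (ExteriorAlgebra.ι K β), ι_mul_ι_comm β α, neg_mul,
          mul_assoc, ExteriorAlgebra.ι_sq_zero]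
        simp
      -- The binomial formula for `(θ - τ) + τ` stops after the linear term, because `τ² = 0`.
      have hpow (m : ℕ) : θ ^ (m + 1) = (θ - τ) ^ (m + 1) + ((m : K) + 1) • (τ * (θ - τ) ^ m) := by
        induction m with
        | zero => simp
        | succ m ihm =>
          rw [pow_succ' θ (m + 1), ihm]
          nth_rw 1 [show θ = (θ - τ) + τ by abel]
          rw [add_mul, mul_add, mul_add, mul_smul_comm, mul_smul_comm, ← mul_assoc τ τ, hττ,
            ← mul_assoc, ← hcomm.eq, mul_assoc τ, ← pow_succ', ← pow_succ']
          push_cast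
          simp only [zero_mul, smul_zero]
          module
      have hiff : θ ^ (k + 1) = 0 ↔ (θ - τ) ^ k = 0 := by
        constructor
        · intro hz
          rw [hpow] at hz
          -- Both contractions kill the powers of `θ - τ`, and together they send `τ` to `1`, which
          -- isolates `(θ - τ) ^ k`.
          have c1 := congrArg (fun x => CliffordAlgebra.contractLeft d₁
            (CliffordAlgebra.contractLeft d₀ x)) hz
          simp only [map_add, map_smul, h'.contract_pow_of_eq_zero e0, map_zero, zero_add] at c1
          rw [contractLeft_mul_of_mem hτ'.mem, h'.contract_pow_of_eq_zero e0, hτ,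
            contractLeft_ι_mul_ι, h0α, h0β] at c1
          simp only [zero_smul, neg_smul, one_smul, zero_sub, neg_neg, mul_zero, add_zero] at c1
          rw [contractLeft_ι_mul', h'.contract_pow_of_eq_zero e1, h₁] at c1
          have : ((k : K) + 1) ≠ 0 := by exact_mod_cast k.succ_ne_zero
          simpa [this] using c1
        · intro hz
          rw [hpow, pow_succ, hz]; simp
      rw [hiff, ih h', hrank]
      omega

theorem isNilpotent [CharZero K] [FiniteDimensional K E] (h : IsBivector θ B) : IsNilpotent θ :=
  ⟨finrank K (LinearMap.range B) + 1, (h.pow_eq_zero_iff _).2 (by omega)⟩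

theorem contract_exp [CharZero K] [FiniteDimensional K E] [Module ℚ (ExteriorAlgebra K E)]
    (h : IsBivector θ B) (d : Dual K E) :
    CliffordAlgebra.contractLeft d (IsNilpotent.exp θ) =
      ExteriorAlgebra.ι K (B d) * IsNilpotent.exp θ := by
  obtain ⟨k, hk⟩ := h.isNilpotent
  -- The series on the left is cut one term later than on the right, since contraction lowers the
  -- power of `θ` by one.
  have hk' : θ ^ (k + 1) = 0 := by rw [pow_succ, hk, zero_mul]
  conv_lhs => rw [IsNilpotent.exp_eq_sum hk']
  rw [IsNilpotent.exp_eq_sum hk, map_sum, Finset.sum_range_succ', Finset.mul_sum]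
  simp only [map_rat_smul, h.contract_pow, mul_smul_comm, pow_zero, contractLeft_one', smul_zero,
    add_zero]
  refine Finset.sum_congr rfl fun i _ => ?_
  have h1 (x : ExteriorAlgebra K E) : ((i : K) + 1) • x = ((i + 1 : ℕ) : ℚ) • x := by
    rw [Nat.cast_smul_eq_nsmul ℚ, ← Nat.cast_smul_eq_nsmul K]
    push_cast
    rfl
  rw [h1, smul_smul, Nat.factorial_succ]
  congr 1
  have : (i.factorial : ℚ) ≠ 0 := by exact_mod_cast i.factorial_ne_zero
  push_cast
  field_simp

/-- The annihilator of `exp θ` is the graph of `-θ`. -/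
theorem annihilator_exp [CharZero K] [FiniteDimensional K E] [Module ℚ (ExteriorAlgebra K E)]
    (h : IsBivector θ B) (d : Dual K E) (e : E) :
    CliffordAlgebra.contractLeft d (IsNilpotent.exp θ) +
      ExteriorAlgebra.ι K e * IsNilpotent.exp θ = 0 ↔ e = -B d := by
  rw [h.contract_exp, ← add_mul, ← map_add, (IsNilpotent.isUnit_exp h.isNilpotent).mul_left_eq_zero,
    ← map_zero (ExteriorAlgebra.ι K), (ExteriorAlgebra.ι_leftInverse (R := K)).injective.eq_iff,
    eq_neg_iff_add_eq_zero, add_comm]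

/-- The annihilator of the top nonvanishing power of a bivector. -/
theorem annihilator_pow [CharZero K] [FiniteDimensional K E] (h : IsBivector θ B) {n : ℕ}
    (hn : finrank K (LinearMap.range B) = 2 * n) (d : Dual K E) (e : E) :
    CliffordAlgebra.contractLeft d (θ ^ n) + ExteriorAlgebra.ι K e * θ ^ n = 0 ↔
      B d = 0 ∧ e ∈ LinearMap.range B := by
  have hne : θ ^ n ≠ 0 := by rw [Ne, h.pow_eq_zero_iff]; omega
  have hz : θ ^ (n + 1) = 0 := by rw [h.pow_eq_zero_iff]; omega
  -- Contract `θ ^ (n + 1) = 0` with a preimage of `e`.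
  have hmem {e : E} (he : e ∈ LinearMap.range B) : ExteriorAlgebra.ι K e * θ ^ n = 0 := by
    obtain ⟨d', rfl⟩ := he
    have := h.contract_pow d' n
    rw [hz, map_zero] at this
    have hk : ((n : K) + 1) ≠ 0 := by exact_mod_cast n.succ_ne_zero
    simpa [hk] using this.symm
  constructor
  · intro hde
    have he : e ∈ LinearMap.range B := by
      by_contra he
      -- A functional that vanishes on the range of `B` but not at `e`. By skewness `B d' = 0`, so
      -- `d'` kills the powers of `θ`, and contracting the hypothesis with it leaves only `d' e • θ
      -- ^ n`.
      obtain ⟨d', hd', hB⟩ := Submodule.exists_le_ker_of_notMem he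
      have hBd' : B d' = 0 := by
        refine (forall_dual_apply_eq_zero_iff K _).1 fun d => ?_
        rw [h.apply_swap, show d' (B d) = 0 from hB ⟨d, rfl⟩, neg_zero]
      have c := congrArg (CliffordAlgebra.contractLeft d') hde
      rw [map_add, contractLeft_ι_mul', CliffordAlgebra.contractLeft_comm,
        h.contract_pow_of_eq_zero hBd'] at c
      simp [hne] at c
      exact hd' c
    refine ⟨?_, he⟩
    rw [hmem he, add_zero] at hde
    cases n with
    | zero =>
      have hr : LinearMap.range B = ⊥ := Submodule.finrank_eq_zero.1 (by simpa using hn)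
      rw [LinearMap.range_eq_bot.1 hr, LinearMap.zero_apply]
    | succ n =>
      by_contra hBd
      obtain ⟨d₁, h₁⟩ : ∃ d₁ : Dual K E, d₁ (B d) ≠ 0 := by
        by_contra! hh
        exact hBd ((forall_dual_apply_eq_zero_iff K _).1 hh)
      have hk : ((n : K) + 1) ≠ 0 := by exact_mod_cast n.succ_ne_zero
      have hz' : ExteriorAlgebra.ι K (B d) * θ ^ n = 0 := by
        simpa [h.contract_pow, hk] using hde
      -- This rewrites `d₁ (B d) • θ ^ n` as `B d` times a contraction of `θ ^ n`. After
      -- multiplication by `θ` the factor `B d ∧ θ ^ n = 0` reappears, so `θ ^ (n + 1)` would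
      -- vanish.
      have c := congrArg (CliffordAlgebra.contractLeft d₁) hz'
      rw [contractLeft_ι_mul', map_zero] at c
      have hθ : d₁ (B d) • θ ^ (n + 1) = 0 := by
        rw [pow_succ', ← mul_smul_comm, sub_eq_zero.1 c]
        cases n with
        | zero => simp
        | succ m =>
          rw [h.contract_pow, mul_smul_comm, mul_smul_comm, (commute_of_mem_twoVectors h.mem _).eq,
            ← mul_assoc, ι_mul_ι_comm, neg_mul, neg_mul, mul_assoc, mul_assoc, ← pow_succ, hz',
            mul_zero, neg_zero, smul_zero]
      exact hne ((smul_eq_zero_iff_right h₁).1 hθ)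
  · rintro ⟨hd, he⟩
    rw [hmem he, h.contract_pow_of_eq_zero hd, add_zero]

end IsBivector

end Exterior

/-! ### Complexified quaternions -/

/-- The imaginary quaternion with complex coefficients `c₀, c₁, c₂`. -/
def imQuat (c : Fin 3 → ℂ) : ℍ[ℂ] := ⟨0, c 0, c 1, c 2⟩

/-- The coefficients of `a₁ b₁ σ - (a₀ b₁ + a₁ b₀) ω_I - a₀ b₀ σ̄`. -/
def sigmaCoeff (a b : Fin 2 → ℂ) : Fin 3 → ℂ :=
  ![-(a 0 * b 1 + a 1 * b 0), a 1 * b 1 - a 0 * b 0, Complex.I * (a 1 * b 1 + a 0 * b 0)]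

/-- The unit imaginary quaternion given by inverse stereographic projection. -/
def stereoQuat (a : Fin 2 → ℂ) : ℍ[ℂ] := imQuat fun i => (stereo a i : ℂ)

theorem normSq_add_ne_zero {a : Fin 2 → ℂ} (ha : a ≠ 0) :
    Complex.normSq (a 0) + Complex.normSq (a 1) ≠ 0 := by
  intro h
  have h0 : Complex.normSq (a 0) = 0 := by
    linarith [Complex.normSq_nonneg (a 0), Complex.normSq_nonneg (a 1)]
  have h1 : Complex.normSq (a 1) = 0 := by linarith
  rw [Complex.normSq_eq_zero] at h0 h1
  exact ha (by ext i; fin_cases i <;> simp [h0, h1])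

theorem conj_mul_add_ne_zero {a : Fin 2 → ℂ} (ha : a ≠ 0) :
    a 0 * conj (a 0) + a 1 * conj (a 1) ≠ 0 := by
  rw [Complex.mul_conj, Complex.mul_conj]
  exact_mod_cast normSq_add_ne_zero ha

/-- Expressing the sphere coordinates rationally in `a` and its conjugates makes the quaternion
identities below commutative ring identities over `ℂ`. -/
theorem stereo_zero_eq (a : Fin 2 → ℂ) : (stereo a 0 : ℂ) =
    (a 0 * conj (a 0) + a 1 * conj (a 1))⁻¹ * (a 1 * conj (a 1) - a 0 * conj (a 0)) := by
  simp [stereo, Complex.mul_conj]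

theorem stereo_one_eq (a : Fin 2 → ℂ) : (stereo a 1 : ℂ) =
    (a 0 * conj (a 0) + a 1 * conj (a 1))⁻¹ * (a 0 * conj (a 1) + a 1 * conj (a 0)) := by
  have : ((2 * (a 0 * conj (a 1)).re : ℝ) : ℂ) = a 0 * conj (a 1) + a 1 * conj (a 0) := by
    push_cast
    rw [Complex.re_eq_add_conj]
    simp
    ring
  rw [← this]
  simp [stereo, Complex.mul_conj]

theorem stereo_two_eq (a : Fin 2 → ℂ) : (stereo a 2 : ℂ) =
    (a 0 * conj (a 0) + a 1 * conj (a 1))⁻¹ *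
      (-Complex.I * (a 0 * conj (a 1) - a 1 * conj (a 0))) := by
  have : ((2 * (a 0 * conj (a 1)).im : ℝ) : ℂ) =
      -Complex.I * (a 0 * conj (a 1) - a 1 * conj (a 0)) := by
    push_cast
    rw [Complex.im_eq_sub_conj]
    have := Complex.I_sq
    rw [mul_div_assoc', div_eq_iff (by simp)]
    simp
    linear_combination 2 * (a 0 * conj (a 1) - a 1 * conj (a 0)) * this
  rw [← this]
  simp [stereo, Complex.mul_conj]

theorem stereo_normSq {a : Fin 2 → ℂ} (ha : a ≠ 0) :
    stereo a 0 ^ 2 + stereo a 1 ^ 2 + stereo a 2 ^ 2 = 1 := by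
  have h := conj_mul_add_ne_zero ha
  have : ((stereo a 0 ^ 2 + stereo a 1 ^ 2 + stereo a 2 ^ 2 : ℝ) : ℂ) = 1 := by
    push_cast
    rw [stereo_zero_eq, stereo_one_eq, stereo_two_eq]
    field_simp
    rw [Complex.I_sq]
    ring
  exact_mod_cast this

@[simp] theorem re_imQuat (c : Fin 3 → ℂ) : (imQuat c).re = 0 := rfl
@[simp] theorem imI_imQuat (c : Fin 3 → ℂ) : (imQuat c).imI = c 0 := rfl
@[simp] theorem imJ_imQuat (c : Fin 3 → ℂ) : (imQuat c).imJ = c 1 := rfl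
@[simp] theorem imK_imQuat (c : Fin 3 → ℂ) : (imQuat c).imK = c 2 := rfl

/-- `a₀ b₁ - a₁ b₀`. -/
def cross (a b : Fin 2 → ℂ) : ℂ := a 0 * b 1 - a 1 * b 0

/-- With `D = I * cross a b` and `θ = imQuat (sigmaCoeff a b)`, the quaternions `D ± θ` have norm
zero, hence are singular in `M₂(ℂ)`. The image of `D - θ` is governed by `a` and its kernel by `b`;
for `D + θ` the roles are exchanged. This and the next three lemmas record these facts as products
that vanish, checked in coordinates. -/
theorem stereoQuat_add_mul {a : Fin 2 → ℂ} (ha : a ≠ 0) (b : Fin 2 → ℂ) :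
    (stereoQuat a + algebraMap ℂ ℍ[ℂ] Complex.I) *
      (algebraMap ℂ ℍ[ℂ] (Complex.I * cross a b) - imQuat (sigmaCoeff a b)) = 0 := by
  have h := conj_mul_add_ne_zero ha
  have hI := Complex.I_sq
  ext <;> simp [stereoQuat, sigmaCoeff, stereo_zero_eq, stereo_one_eq, stereo_two_eq, cross,
      Quaternion.algebraMap_def] <;> field_simp <;> ring_nf <;> simp only [hI] <;> ring

theorem stereoQuat_add_mul' {b : Fin 2 → ℂ} (hb : b ≠ 0) (a : Fin 2 → ℂ) :
    (stereoQuat b + algebraMap ℂ ℍ[ℂ] Complex.I) *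
      (algebraMap ℂ ℍ[ℂ] (Complex.I * cross a b) + imQuat (sigmaCoeff a b)) = 0 := by
  have h := conj_mul_add_ne_zero hb
  have hI := Complex.I_sq
  ext <;> simp [stereoQuat, sigmaCoeff, stereo_zero_eq, stereo_one_eq, stereo_two_eq, cross,
      Quaternion.algebraMap_def] <;> field_simp <;> ring_nf <;> simp only [hI] <;> ring

theorem mul_stereoQuat_sub {a : Fin 2 → ℂ} (ha : a ≠ 0) (b : Fin 2 → ℂ) :
    (algebraMap ℂ ℍ[ℂ] (Complex.I * cross a b) + imQuat (sigmaCoeff a b)) *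
      (stereoQuat a - algebraMap ℂ ℍ[ℂ] Complex.I) = 0 := by
  have h := conj_mul_add_ne_zero ha
  have hI := Complex.I_sq
  ext <;> simp [stereoQuat, sigmaCoeff, stereo_zero_eq, stereo_one_eq, stereo_two_eq, cross,
      Quaternion.algebraMap_def] <;> field_simp <;> ring_nf <;> simp only [hI] <;> ring

theorem mul_stereoQuat_sub' {b : Fin 2 → ℂ} (hb : b ≠ 0) (a : Fin 2 → ℂ) :
    (algebraMap ℂ ℍ[ℂ] (Complex.I * cross a b) - imQuat (sigmaCoeff a b)) *
      (stereoQuat b - algebraMap ℂ ℍ[ℂ] Complex.I) = 0 := by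
  have h := conj_mul_add_ne_zero hb
  have hI := Complex.I_sq
  ext <;> simp [stereoQuat, sigmaCoeff, stereo_zero_eq, stereo_one_eq, stereo_two_eq, cross,
      Quaternion.algebraMap_def] <;> field_simp <;> ring_nf <;> simp only [hI] <;> ring

/-- The map is the Segre embedding in other linear coordinates: the four products `a i * b j` are
recovered linearly. Nonvanishing and injectivity both follow from this. -/
theorem quadricPoint_products (a b : Fin 2 → ℂ) :
    a 0 * b 0 = -(quadricPoint a b 1 + Complex.I * quadricPoint a b 2) / 2 ∧
    a 1 * b 1 = (quadricPoint a b 1 - Complex.I * quadricPoint a b 2) / 2 ∧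
    a 0 * b 1 = -(quadricPoint a b 0 + Complex.I * quadricPoint a b 3) / 2 ∧
    a 1 * b 0 = -(quadricPoint a b 0 - Complex.I * quadricPoint a b 3) / 2 := by
  have hI := Complex.I_mul_I
  simp only [quadricPoint, Matrix.cons_val]
  refine ⟨?_, ?_, ?_, ?_⟩ <;> grind

theorem quadricPoint_ne_zero {a b : Fin 2 → ℂ} (ha : a ≠ 0) (hb : b ≠ 0) :
    quadricPoint a b ≠ 0 := by
  intro h
  obtain ⟨i, hi⟩ := Function.ne_iff.1 ha
  obtain ⟨j, hj⟩ := Function.ne_iff.1 hb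
  have hij := mul_ne_zero hi hj
  obtain ⟨h0, h1, h2, h3⟩ := quadricPoint_products a b
  rw [h] at h0 h1 h2 h3
  simp only [Pi.zero_apply, mul_zero, add_zero, sub_zero, neg_zero, zero_div] at h0 h1 h2 h3
  fin_cases i <;> fin_cases j <;> exact hij ‹_›

theorem sigmaCoeff_ne_zero {a b : Fin 2 → ℂ} (ha : a ≠ 0) (hb : b ≠ 0) (h : cross a b = 0) :
    sigmaCoeff a b ≠ 0 := by
  intro h'
  apply quadricPoint_ne_zero ha hb
  have h0 := congrFun h' 0
  have h1 := congrFun h' 1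
  have h2 := congrFun h' 2
  unfold cross at h
  funext i
  fin_cases i
  exacts [h0, h1, h2, by simp [quadricPoint, h]]

/-- For imaginary quaternions `u v + v u = -2 u · v`, and `c · c̄ > 0`, so a multiple of `c̄`
serves. When `imQuat c` has square zero, `r` is a contracting homotopy and shows that the kernel of
`imQuat c` lies in its image. -/
theorem exists_anticommutator_eq_one {c : Fin 3 → ℂ} (hc : c ≠ 0) :
    ∃ r : ℍ[ℂ], imQuat c * r + r * imQuat c = 1 := by
  set N : ℂ := c 0 * conj (c 0) + c 1 * conj (c 1) + c 2 * conj (c 2) with hN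
  have hN0 : N ≠ 0 := by
    intro h
    simp only [hN, Complex.mul_conj] at h
    have h' : Complex.normSq (c 0) + Complex.normSq (c 1) + Complex.normSq (c 2) = 0 := by
      exact_mod_cast h
    have := Complex.normSq_nonneg (c 0)
    have := Complex.normSq_nonneg (c 1)
    have := Complex.normSq_nonneg (c 2)
    apply hc
    ext i
    fin_cases i <;> refine Complex.normSq_eq_zero.1 ?_ <;>
      simp only [Fin.zero_eta, Fin.mk_one, Fin.reduceFinMk] <;> linarith
  refine ⟨imQuat fun i => -(2 * N)⁻¹ * conj (c i), ?_⟩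
  ext <;> simp
  · field_simp
    rw [hN]
    ring
  all_goals ring

/-! ### Hyperkähler structures on a vector space -/

/-- An inner product on a real vector space with a compatible quaternionic structure. -/
structure LinearHyperkahler (V : Type*) [AddCommGroup V] [Module ℝ V] [TopologicalSpace V]
    [IsTopologicalAddGroup V] [ContinuousSMul ℝ V] where
  g : V →L[ℝ] (V →L[ℝ] ℝ)
  I : V →L[ℝ] V
  J : V →L[ℝ] V
  K : V →L[ℝ] V
  symm : ∀ u v, g u v = g v u
  pos : ∀ v, v ≠ 0 → 0 < g v v
  II : ∀ u, I (I u) = -u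
  JJ : ∀ u, J (J u) = -u
  KK : ∀ u, K (K u) = -u
  IJ : ∀ u, I (J u) = K u
  JI : ∀ u, J (I u) = -K u
  JK : ∀ u, J (K u) = I u
  KJ : ∀ u, K (J u) = -I u
  KI : ∀ u, K (I u) = J u
  IK : ∀ u, I (K u) = -J u
  skew_I : ∀ u v, g (I u) v = -g u (I v)
  skew_J : ∀ u v, g (J u) v = -g u (J v)
  skew_K : ∀ u v, g (K u) v = -g u (K v)

/-! ### Complex covectors and two-forms as bivectors. -/

section Covectors

variable {V : Type*} [AddCommGroup V] [Module ℝ V] [TopologicalSpace V]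
  [IsTopologicalAddGroup V] [ContinuousSMul ℝ V]

/-- The complex covector `ξ + i ξ'`. -/
def complexCovector (ξ ξ' : V →L[ℝ] ℝ) : V →ₗ[ℝ] ℂ := toComplex ξ + Complex.I • toComplex ξ'

theorem complexCovector_apply (ξ ξ' : V →L[ℝ] ℝ) (v : V) :
    complexCovector ξ ξ' v = (ξ v : ℂ) + Complex.I * (ξ' v : ℂ) := rfl

theorem re_complexCovector (ξ ξ' : V →L[ℝ] ℝ) (v : V) : (complexCovector ξ ξ' v).re = ξ v := by
  simp [complexCovector_apply]

theorem im_complexCovector (ξ ξ' : V →L[ℝ] ℝ) (v : V) : (complexCovector ξ ξ' v).im = ξ' v := by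
  simp [complexCovector_apply]

theorem complexCovector_inj {ξ ξ' τ τ' : V →L[ℝ] ℝ} :
    complexCovector ξ ξ' = complexCovector τ τ' ↔ ξ = τ ∧ ξ' = τ' := by
  constructor
  · intro h
    constructor <;> ext v
    · rw [← re_complexCovector ξ ξ', h, re_complexCovector]
    · rw [← im_complexCovector ξ ξ', h, im_complexCovector]
  · rintro ⟨rfl, rfl⟩; rfl

/-- Evaluation at the complex vector `X + i X'`. -/
def evalComplex (X X' : V) : Module.Dual ℂ (V →ₗ[ℝ] ℂ) := evalAt X + Complex.I • evalAt X'

/-- Puts the complexified Clifford action in the form to which the annihilator lemmas for bivectors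
apply. -/
theorem cliffordAct_add_I_smul (u v : V × (V →L[ℝ] ℝ)) (φ : Forms V) :
    cliffordAct u φ + Complex.I • cliffordAct v φ =
      CliffordAlgebra.contractLeft (evalComplex u.1 v.1) φ +
        ExteriorAlgebra.ι ℂ (complexCovector u.2 v.2) * φ := by
  simp only [cliffordAct, evalComplex, complexCovector, map_add, map_smul, LinearMap.add_apply,
    LinearMap.smul_apply, add_mul, smul_mul_assoc, smul_add]
  abel

variable [FiniteDimensional ℝ V]

/-- Every functional on complex covectors is a complex combination of evaluations at real vectors,
so contractions need only be computed for the latter. -/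
theorem sum_evalAt (d : Module.Dual ℂ (V →ₗ[ℝ] ℂ)) :
    ∑ i, d (Complex.ofRealCLM.toLinearMap ∘ₗ (Module.finBasis ℝ V).coord i) •
      evalAt (Module.finBasis ℝ V i) = d := by
  ext f
  have hf : f = ∑ i, f (Module.finBasis ℝ V i) •
      (Complex.ofRealCLM.toLinearMap ∘ₗ (Module.finBasis ℝ V).coord i) := by
    refine (Module.finBasis ℝ V).ext fun j => ?_
    simp [LinearMap.sum_apply, Finsupp.single_apply, apply_ite Complex.ofReal]
  conv_rhs => rw [hf]
  simp [LinearMap.sum_apply, evalAt, mul_comm]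

theorem isBivector_twoForm (w : V →L[ℝ] (V →L[ℝ] ℝ)) (hw : ∀ u v, w u v = -w v u)
    (B : Module.Dual ℂ (V →ₗ[ℝ] ℂ) →ₗ[ℂ] (V →ₗ[ℝ] ℂ))
    (hB : ∀ X, B (evalAt X) = toComplex (w X)) : IsBivector (twoForm w) B := by
  constructor
  · exact Submodule.smul_mem _ _ (sum_mem fun i _ => Submodule.subset_span ⟨_, _, rfl⟩)
  · suffices key : ∀ X, CliffordAlgebra.contractLeft (evalAt X) (twoForm w) =
        ExteriorAlgebra.ι ℂ (B (evalAt X)) by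
      intro d
      rw [← sum_evalAt d]
      simp only [map_sum, LinearMap.sum_apply, map_smul, LinearMap.smul_apply, key]
    intro X
    simp only [hB, twoForm, map_smul, map_sum, contractLeft_ι_mul_ι]
    rw [← map_sum, ← map_smul]
    congr 1
    ext Y
    -- Contracting `∑ eⁱ ∧ w(eᵢ)` with `X` gives `w(X, ·) - w(·, X)`, which is `2 w(X, ·)` by
    -- skewness; the factor `½` in `twoForm` compensates.
    have h1 := (Module.finBasis ℝ V).sum_repr X
    have h2 := (Module.finBasis ℝ V).sum_repr Y
    have e1 : ∑ i, (Module.finBasis ℝ V).repr X i * w (Module.finBasis ℝ V i) Y = w X Y := by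
      simpa [sum_apply, -Module.Basis.sum_repr] using congrArg (fun Z => w Z Y) h1
    have e2 : ∑ i, w (Module.finBasis ℝ V i) X * (Module.finBasis ℝ V).repr Y i = w Y X := by
      simpa [sum_apply, mul_comm, -Module.Basis.sum_repr] using congrArg (fun Z => w Z X) h2
    simp only [LinearMap.smul_apply, LinearMap.sum_apply, LinearMap.sub_apply,
      Finset.sum_sub_distrib, LinearMap.comp_apply, evalAt, LinearMap.coe_mk, AddHom.coe_mk,
      Module.Basis.coord_apply, toComplex, smul_eq_mul]
    simp only [ContinuousLinearMap.coe_coe, Complex.ofRealCLM_apply, ← Complex.ofReal_mul,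
      ← Complex.ofReal_sum, e1, e2, hw Y X]
    push_cast
    ring

end Covectors

namespace LinearHyperkahler

variable {V : Type*} [AddCommGroup V] [Module ℝ V] [TopologicalSpace V]
  [IsTopologicalAddGroup V] [ContinuousSMul ℝ V] (L : LinearHyperkahler V)

/-- `c₀ I + c₁ J + c₂ K`. -/
def cplx (c : Fin 3 → ℝ) : V →L[ℝ] V := c 0 • L.I + c 1 • L.J + c 2 • L.K

theorem cplx_apply (c : Fin 3 → ℝ) (u : V) :
    L.cplx c u = c 0 • L.I u + c 1 • L.J u + c 2 • L.K u := rfl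

theorem cplx_cplx (c : Fin 3 → ℝ) (u : V) :
    L.cplx c (L.cplx c u) = -(c 0 ^ 2 + c 1 ^ 2 + c 2 ^ 2) • u := by
  simp only [cplx_apply, map_add, map_smul, L.II, L.JJ, L.KK, L.IJ, L.JI, L.JK, L.KJ, L.KI, L.IK]
  module

theorem skew (c : Fin 3 → ℝ) (u v : V) : L.g (L.cplx c u) v = -L.g u (L.cplx c v) := by
  simp only [cplx_apply, map_add, map_smul, add_apply,
    smul_apply, L.skew_I, L.skew_J, L.skew_K, smul_eq_mul]
  ring

/-- Minus the precomposition with an endomorphism. -/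
def negPrecomp (A : V →L[ℝ] V) : Module.End ℂ (V →ₗ[ℝ] ℂ) where
  toFun f := -(f ∘ₗ (A : V →ₗ[ℝ] V))
  map_add' f h := by rw [LinearMap.add_comp, neg_add]
  map_smul' r f := by rw [LinearMap.smul_comp, ← smul_neg]; rfl

theorem negPrecomp_apply (A : V →L[ℝ] V) (f : V →ₗ[ℝ] ℂ) (v : V) :
    negPrecomp A f v = -f (A v) := rfl

/-- The action of complexified quaternions on complex covectors. -/
def rep : ℍ[ℂ] →ₐ[ℂ] Module.End ℂ (V →ₗ[ℝ] ℂ) :=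
  QuaternionAlgebra.Basis.liftHom
    -- Precomposition reverses products, and the signs compensate: the relation `JI = -K` on vectors
    -- becomes `ij = k` here. As `I, J, K` are skew for `g`, the action carries `g(X)` to `g(I X)`,
    -- and so on.
    { i := negPrecomp L.I
      j := negPrecomp L.J
      k := negPrecomp L.K
      i_mul_i := by ext f v; simp [negPrecomp_apply, L.II]
      j_mul_j := by ext f v; simp [negPrecomp_apply, L.JJ]
      i_mul_j := by ext f v; simp [negPrecomp_apply, L.JI]
      j_mul_i := by ext f v; simp [negPrecomp_apply, L.IJ] }

theorem rep_imQuat_apply (c : Fin 3 → ℂ) (f : V →ₗ[ℝ] ℂ) (v : V) :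
    L.rep (imQuat c) f v = -(c 0 * f (L.I v) + c 1 * f (L.J v) + c 2 * f (L.K v)) := by
  have : L.rep (imQuat c) = algebraMap ℂ _ 0 + c 0 • negPrecomp L.I + c 1 • negPrecomp L.J +
      c 2 • negPrecomp L.K := rfl
  rw [this]
  simp [negPrecomp_apply]
  ring

theorem rep_imQuat_complexCovector (c : Fin 3 → ℂ) (X X' : V) :
    L.rep (imQuat c) (complexCovector (L.g X) (L.g X')) =
      complexCovector
        (L.g (L.cplx (fun i => (c i).re) X) - L.g (L.cplx (fun i => (c i).im) X'))
        (L.g (L.cplx (fun i => (c i).re) X') + L.g (L.cplx (fun i => (c i).im) X)) := by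
  ext v
  rw [rep_imQuat_apply]
  simp only [complexCovector_apply, sub_apply, add_apply,
    skew]
  simp only [cplx_apply, map_add, map_smul, smul_eq_mul]
  apply Complex.ext <;> simp <;> ring

theorem rep_ofReal_complexCovector (c : Fin 3 → ℝ) (X X' : V) :
    L.rep (imQuat fun i => (c i : ℂ)) (complexCovector (L.g X) (L.g X')) =
      complexCovector (L.g (L.cplx c X)) (L.g (L.cplx c X')) := by
  rw [rep_imQuat_complexCovector]
  have : L.cplx (fun _ => 0) = 0 := by ext v; simp [cplx_apply]
  simp [this]

theorem injective : Function.Injective L.g := by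
  rw [injective_iff_map_eq_zero]
  intro u hu
  by_contra h
  have := L.pos u h
  rw [hu] at this
  simp at this

/-- The form `g(c · , ·)`. -/
def kahler (c : Fin 3 → ℝ) : V →L[ℝ] (V →L[ℝ] ℝ) := L.g.comp (L.cplx c)

theorem kahler_apply (c : Fin 3 → ℝ) (u : V) : L.kahler c u = L.g (L.cplx c u) := rfl

variable [T2Space V] [FiniteDimensional ℝ V]

/-- The musical isomorphism. -/
def flat : V ≃ₗ[ℝ] (V →L[ℝ] ℝ) :=
  LinearMap.linearEquivOfInjective (L.g : V →ₗ[ℝ] (V →L[ℝ] ℝ)) L.injective (by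
    rw [← (LinearMap.toContinuousLinearMap : (V →ₗ[ℝ] ℝ) ≃ₗ[ℝ] (V →L[ℝ] ℝ)).finrank_eq]
    exact Subspace.dual_finrank_eq.symm)

theorem g_flat_symm (ξ : V →L[ℝ] ℝ) : L.g (L.flat.symm ξ) = ξ := L.flat.apply_symm_apply ξ

theorem exists_eq_g (ξ : V →L[ℝ] ℝ) : ∃ Y, ξ = L.g Y := ⟨L.flat.symm ξ, (L.g_flat_symm ξ).symm⟩

/-- As the square of `L.cplx c` is `-1`, the inverse is `-L.cplx c` composed with the inverse of
`g`. So on the unit sphere inversion becomes linear in `c`, which is what allows inverse symplectic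
forms to be combined. -/
theorem inverse_apply {c : Fin 3 → ℝ} (hc : c 0 ^ 2 + c 1 ^ 2 + c 2 ^ 2 = 1) (Y : V) :
    (L.g.comp (L.cplx c)).inverse (L.g Y) = -L.cplx c Y := by
  have : FiniteDimensional ℝ (V →L[ℝ] ℝ) := L.flat.finiteDimensional
  have hcont : Continuous L.flat.symm := LinearMap.continuous_of_finiteDimensional
    (L.flat.symm : (V →L[ℝ] ℝ) →ₗ[ℝ] V)
  let S : (V →L[ℝ] ℝ) →L[ℝ] V := ⟨L.flat.symm, hcont⟩
  have hS (u : V) : S (L.g u) = u := L.flat.symm_apply_apply u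
  have hS' (ξ : V →L[ℝ] ℝ) : L.g (S ξ) = ξ := L.g_flat_symm ξ
  have : (L.g.comp (L.cplx c)).inverse = (-L.cplx c).comp S := by
    apply ContinuousLinearMap.inverse_eq
    · ext1 ξ
      simp [cplx_cplx, hc, hS']
    · ext1 u
      simp [cplx_cplx, hc, hS]
  rw [this]
  simp [hS]

theorem transpose_g (c : Fin 3 → ℝ) (Y : V) :
    transpose (L.cplx c) (L.g Y) = -L.g (L.cplx c Y) := by
  ext v
  simp [transpose, skew]

/-- The sum of the two vectors on the right is `-L.cplx q (X + Y)` and their difference is `-L.cplx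
p (X - Y)`: the endomorphism is `-I₋` on the graph of `g` and `-I₊` on the graph of `-g`. -/
theorem gualtieri_apply {p q : Fin 3 → ℝ} (hp : p 0 ^ 2 + p 1 ^ 2 + p 2 ^ 2 = 1)
    (hq : q 0 ^ 2 + q 1 ^ 2 + q 2 ^ 2 = 1) (X Y : V) :
    gualtieri L.g (L.cplx p) (L.cplx q) (X, L.g Y) =
      ((1 / 2 : ℝ) • (-(L.cplx p X + L.cplx q X) + (L.cplx p Y - L.cplx q Y)),
        L.g ((1 / 2 : ℝ) • (L.cplx p X - L.cplx q X - (L.cplx p Y + L.cplx q Y)))) := by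
  ext1
  · change (1 / 2 : ℝ) • (-(L.cplx p X + L.cplx q X) +
      -((L.g.comp (L.cplx p)).inverse (L.g Y) - (L.g.comp (L.cplx q)).inverse (L.g Y))) = _
    rw [L.inverse_apply hp, L.inverse_apply hq]
    module
  · change (1 / 2 : ℝ) • (L.g (L.cplx p X) - L.g (L.cplx q X) +
      (transpose (L.cplx p) (L.g Y) + transpose (L.cplx q) (L.g Y))) = _
    rw [L.transpose_g, L.transpose_g]
    simp only [map_add, map_sub, map_smul]
    module

theorem genOfComplex_apply (c : Fin 3 → ℝ) (X Y : V) :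
    genOfComplex (L.cplx c) (X, L.g Y) = (-L.cplx c X, L.g (-L.cplx c Y)) := by
  ext1 <;> simp [genOfComplex, block, L.transpose_g]

theorem genOfSymplectic_apply {c : Fin 3 → ℝ} (hc : c 0 ^ 2 + c 1 ^ 2 + c 2 ^ 2 = 1) (X Y : V) :
    genOfSymplectic (L.kahler c) (X, L.g Y) = (L.cplx c Y, L.g (L.cplx c X)) := by
  have h : (-(L.kahler c).inverse) (L.g Y) = L.cplx c Y := by
    change -((L.g.comp (L.cplx c)).inverse (L.g Y)) = _
    rw [L.inverse_apply hc, neg_neg]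
  ext1
  · simpa [genOfSymplectic, block] using h
  · simp [genOfSymplectic, block, kahler]

theorem pairing_g (X Y X' Y' : V) :
    pairing (X, L.g Y) (X', L.g Y') = (1 / 2) * (L.g Y X' + L.g Y' X) := rfl

theorem g_cplx_cplx {c : Fin 3 → ℝ} (hc : c 0 ^ 2 + c 1 ^ 2 + c 2 ^ 2 = 1) (u v : V) :
    L.g (L.cplx c u) (L.cplx c v) = L.g u v := by
  rw [skew, cplx_cplx, hc]; simp

theorem gualtieri_gualtieri {p q : Fin 3 → ℝ} (hp : p 0 ^ 2 + p 1 ^ 2 + p 2 ^ 2 = 1)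
    (hq : q 0 ^ 2 + q 1 ^ 2 + q 2 ^ 2 = 1) (u : V × (V →L[ℝ] ℝ)) :
    gualtieri L.g (L.cplx p) (L.cplx q) (gualtieri L.g (L.cplx p) (L.cplx q) u) = -u := by
  obtain ⟨X, ξ⟩ := u
  obtain ⟨Y, rfl⟩ := L.exists_eq_g ξ
  rw [L.gualtieri_apply hp hq, L.gualtieri_apply hp hq]
  ext1
  · simp only [map_add, map_sub, map_smul, map_neg, cplx_cplx, hp, hq, Prod.fst_neg]
    module
  · rw [Prod.snd_neg, ← map_neg]
    refine congrArg L.g ?_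
    simp only [map_add, map_sub, map_smul, map_neg, cplx_cplx, hp, hq]
    module

theorem pairing_gualtieri {p q : Fin 3 → ℝ} (hp : p 0 ^ 2 + p 1 ^ 2 + p 2 ^ 2 = 1)
    (hq : q 0 ^ 2 + q 1 ^ 2 + q 2 ^ 2 = 1) (u v : V × (V →L[ℝ] ℝ)) :
    pairing (gualtieri L.g (L.cplx p) (L.cplx q) u) (gualtieri L.g (L.cplx p) (L.cplx q) v) =
      pairing u v := by
  obtain ⟨X, ξ⟩ := u
  obtain ⟨Y, rfl⟩ := L.exists_eq_g ξ
  obtain ⟨X', ξ'⟩ := v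
  obtain ⟨Y', rfl⟩ := L.exists_eq_g ξ'
  rw [L.gualtieri_apply hp hq, L.gualtieri_apply hp hq, pairing_g, pairing_g]
  simp only [map_add, map_sub, map_smul, map_neg, add_apply,
    sub_apply, smul_apply,
    L.g_cplx_cplx hp, L.g_cplx_cplx hq, smul_eq_mul]
  rw [L.symm (L.cplx q Y') (L.cplx p Y), L.symm (L.cplx q Y') (L.cplx p X),
    L.symm (L.cplx q X') (L.cplx p Y), L.symm (L.cplx q X') (L.cplx p X), L.symm X' Y, L.symm X Y',
    L.symm (L.cplx p Y') (L.cplx q Y), L.symm (L.cplx p Y') (L.cplx q X),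
    L.symm (L.cplx p X') (L.cplx q Y), L.symm (L.cplx p X') (L.cplx q X)]
  ring

/-- The eigenspaces of Gualtieri's endomorphism in terms of the two complex structures. -/
theorem inEigen_gualtieri_iff {p q : Fin 3 → ℝ} (hp : p 0 ^ 2 + p 1 ^ 2 + p 2 ^ 2 = 1)
    (hq : q 0 ^ 2 + q 1 ^ 2 + q 2 ^ 2 = 1) (X X' Y Y' : V) :
    InEigen (gualtieri L.g (L.cplx p) (L.cplx q)) (X, L.g Y) (X', L.g Y') ↔
      L.cplx q (X + Y) = X' + Y' ∧ L.cplx p (X - Y) = X' - Y' := by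
  have h1 : InEigen (gualtieri L.g (L.cplx p) (L.cplx q)) (X, L.g Y) (X', L.g Y') ↔
      gualtieri L.g (L.cplx p) (L.cplx q) (X, L.g Y) = -(X', L.g Y') := by
    refine ⟨fun h => h.1, fun h => ⟨h, ?_⟩⟩
    rw [← neg_neg (X', L.g Y'), ← h, map_neg, L.gualtieri_gualtieri hp hq, neg_neg]
  rw [h1, L.gualtieri_apply hp hq, Prod.neg_mk, Prod.mk.injEq, ← map_neg, L.injective.eq_iff,
    map_add, map_sub]
  constructor
  · rintro ⟨e1, e2⟩
    rw [eq_neg_iff_add_eq_zero] at e1 e2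
    constructor
    · linear_combination (norm := module) (-1 : ℝ) • e1 - (1 : ℝ) • e2
    · linear_combination (norm := module) (-1 : ℝ) • e1 + (1 : ℝ) • e2
  · rintro ⟨e1, e2⟩
    constructor
    · linear_combination (norm := module) -(1 / 2 : ℝ) • e1 - (1 / 2 : ℝ) • e2
    · linear_combination (norm := module) -(1 / 2 : ℝ) • e1 + (1 / 2 : ℝ) • e2

end LinearHyperkahler

theorem mul_eq_zero_of_mul_zero_sub {R : Type*} [Ring R] {x y : R} (h : x * (0 - y) = 0) :
    x * y = 0 := by
  simpa using h

theorem mul_eq_zero_of_zero_sub_mul {R : Type*} [Ring R] {x y : R} (h : (0 - x) * y = 0) :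
    x * y = 0 := by
  simpa using h

/-! ### Eigenspaces and pure spinors at a point. -/

namespace LinearHyperkahler

variable {V : Type*} [AddCommGroup V] [Module ℝ V] [TopologicalSpace V]
  [IsTopologicalAddGroup V] [ContinuousSMul ℝ V] (L : LinearHyperkahler V)

/-- The real part of the equation is `L.cplx c X = X'`; the imaginary part then follows because the
complex structure has square `-1`. -/
theorem rep_add_I_eq_zero_iff {c : Fin 3 → ℝ} (hc : c 0 ^ 2 + c 1 ^ 2 + c 2 ^ 2 = 1) (X X' : V) :
    L.rep (imQuat (fun i => (c i : ℂ)) + algebraMap ℂ ℍ[ℂ] Complex.I)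
      (complexCovector (L.g X) (L.g X')) = 0 ↔ L.cplx c X = X' := by
  have h : L.rep (imQuat (fun i => (c i : ℂ)) + algebraMap ℂ ℍ[ℂ] Complex.I)
      (complexCovector (L.g X) (L.g X')) =
        complexCovector (L.g (L.cplx c X - X')) (L.g (L.cplx c X' + X)) := by
    rw [map_add, AlgHom.commutes, LinearMap.add_apply, rep_ofReal_complexCovector,
      Module.algebraMap_end_apply]
    ext v
    simp only [LinearMap.add_apply, LinearMap.smul_apply, complexCovector_apply, map_sub, map_add,
      sub_apply, add_apply, smul_eq_mul, Complex.ofReal_sub, Complex.ofReal_add]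
    linear_combination (L.g X' v : ℂ) * Complex.I_mul_I
  have h0 : complexCovector (0 : V →L[ℝ] ℝ) 0 = 0 := by ext v; simp [complexCovector_apply]
  rw [h, ← h0, complexCovector_inj, ← map_zero L.g, L.injective.eq_iff, L.injective.eq_iff,
    sub_eq_zero]
  refine ⟨fun h => h.1, ?_⟩
  rintro rfl
  rw [cplx_cplx, hc]
  simp

variable [FiniteDimensional ℝ V]

/-- The musical map on complexified vectors, seen as functionals on complex covectors. -/
def flatComplex : Module.Dual ℂ (V →ₗ[ℝ] ℂ) →ₗ[ℂ] (V →ₗ[ℝ] ℂ) :=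
  ∑ i, (Module.Dual.eval ℂ (V →ₗ[ℝ] ℂ)
    (Complex.ofRealCLM.toLinearMap ∘ₗ (Module.finBasis ℝ V).coord i)).smulRight
      (toComplex (L.g (Module.finBasis ℝ V i)))

theorem flatComplex_evalAt (X : V) : L.flatComplex (evalAt X) = toComplex (L.g X) := by
  ext Y
  have h1 := (Module.finBasis ℝ V).sum_repr X
  have e1 : ∑ i, (Module.finBasis ℝ V).repr X i * L.g (Module.finBasis ℝ V i) Y = L.g X Y := by
    simpa [sum_apply, -Module.Basis.sum_repr] using congrArg (fun Z => L.g Z Y) h1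
  simp only [flatComplex, toComplex, evalAt, LinearMap.sum_apply, LinearMap.smulRight_apply,
    Module.Dual.eval_apply, LinearMap.coe_mk, AddHom.coe_mk, LinearMap.smul_apply,
    LinearMap.comp_apply, ContinuousLinearMap.coe_coe, Complex.ofRealCLM_apply,
    Module.Basis.coord_apply, smul_eq_mul]
  rw [← e1]
  push_cast
  rfl

theorem flatComplex_evalComplex (X X' : V) :
    L.flatComplex (evalComplex X X') = complexCovector (L.g X) (L.g X') := by
  simp [evalComplex, complexCovector, flatComplex_evalAt]

theorem finrank_covectors : Module.finrank ℂ (V →ₗ[ℝ] ℂ) = Module.finrank ℝ V :=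
  Module.finrank_linearMap_self ℝ ℂ V

theorem exists_complexCovector [T2Space V] (f : V →ₗ[ℝ] ℂ) :
    ∃ X X' : V, f = complexCovector (L.g X) (L.g X') := by
  obtain ⟨X, hX⟩ := L.exists_eq_g (LinearMap.toContinuousLinearMap
    (Complex.reCLM.toLinearMap ∘ₗ f))
  obtain ⟨X', hX'⟩ := L.exists_eq_g (LinearMap.toContinuousLinearMap
    (Complex.imCLM.toLinearMap ∘ₗ f))
  refine ⟨X, X', ?_⟩
  rw [← hX, ← hX']
  ext v
  rw [complexCovector_apply, mul_comm]
  exact (Complex.re_add_im (f v)).symm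

theorem range_flatComplex [T2Space V] : LinearMap.range L.flatComplex = ⊤ := by
  rw [LinearMap.range_eq_top]
  intro f
  obtain ⟨X, X', rfl⟩ := L.exists_complexCovector f
  exact ⟨_, L.flatComplex_evalComplex X X'⟩

theorem isBivector_kahler (c : Fin 3 → ℝ) :
    IsBivector (twoForm (L.kahler c)) (L.rep (imQuat fun i => (c i : ℂ)) ∘ₗ L.flatComplex) := by
  refine isBivector_twoForm _ (fun u v => ?_) _ fun X => ?_
  · rw [kahler_apply, kahler_apply, skew, L.symm]
  · have h := L.rep_ofReal_complexCovector c X 0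
    have h0 : toComplex (0 : V →L[ℝ] ℝ) = 0 := by ext v; simp [toComplex]
    simp only [complexCovector, map_zero, h0, smul_zero, add_zero] at h
    rw [LinearMap.comp_apply, flatComplex_evalAt, h, kahler_apply]

/-- The complex two-form `c₀ ω_I + c₁ ω_J + c₂ ω_K`. -/
def form (c : Fin 3 → ℂ) : Forms V :=
  c 0 • twoForm (L.kahler ![1, 0, 0]) + c 1 • twoForm (L.kahler ![0, 1, 0]) +
    c 2 • twoForm (L.kahler ![0, 0, 1])

theorem isBivector_form (c : Fin 3 → ℂ) :
    IsBivector (L.form c) (L.rep (imQuat c) ∘ₗ L.flatComplex) := by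
  have h := (((L.isBivector_kahler ![1, 0, 0]).smul (c 0)).add
    ((L.isBivector_kahler ![0, 1, 0]).smul (c 1))).add ((L.isBivector_kahler ![0, 0, 1]).smul (c 2))
  have e : L.rep (imQuat c) ∘ₗ L.flatComplex =
      c 0 • (L.rep (imQuat fun i => ((![1, 0, 0] : Fin 3 → ℝ) i : ℂ)) ∘ₗ L.flatComplex) +
      c 1 • (L.rep (imQuat fun i => ((![0, 1, 0] : Fin 3 → ℝ) i : ℂ)) ∘ₗ L.flatComplex) +
      c 2 • (L.rep (imQuat fun i => ((![0, 0, 1] : Fin 3 → ℝ) i : ℂ)) ∘ₗ L.flatComplex) := by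
    ext d v
    simp [rep_imQuat_apply]
    ring
  rw [e]
  exact h

/-- The spinor `iⁿ (α - β)ⁿ exp ((σ - (α + β) ω_I - α β σ̄) / (i (α - β)))`. -/
def spinor (n : ℕ) (a b : Fin 2 → ℂ) : Forms V :=
  if cross a b = 0 then (n.factorial : ℂ)⁻¹ • L.form (sigmaCoeff a b) ^ n
  else (Complex.I * cross a b) ^ n •
    IsNilpotent.exp ((Complex.I * cross a b)⁻¹ • L.form (sigmaCoeff a b))

variable {L}

theorem rep_mul_apply_eq_zero {x y : ℍ[ℂ]} (h : x * y = 0) (f : V →ₗ[ℝ] ℂ) :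
    L.rep x (L.rep y f) = 0 := by
  rw [← Module.End.mul_apply, ← map_mul, h, map_zero, LinearMap.zero_apply]

/-- If `y` acts on `f` as `-i`, then `y - i` acts as `-2i`; so `f` is a multiple of a vector in the
image of `y - i`, which `x` kills. -/
theorem rep_of_mul_sub_eq_zero {x y : ℍ[ℂ]} (h : x * (y - algebraMap ℂ ℍ[ℂ] Complex.I) = 0)
    {f : V →ₗ[ℝ] ℂ} (hf : L.rep (y + algebraMap ℂ ℍ[ℂ] Complex.I) f = 0) : L.rep x f = 0 := by
  have h1 := rep_mul_apply_eq_zero (L := L) h f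
  have h2 : L.rep (y - algebraMap ℂ ℍ[ℂ] Complex.I) f = (-(2 * Complex.I)) • f := by
    rw [map_add, AlgHom.commutes, LinearMap.add_apply, Module.algebraMap_end_apply] at hf
    rw [map_sub, AlgHom.commutes, LinearMap.sub_apply, Module.algebraMap_end_apply,
      eq_neg_of_add_eq_zero_left hf]
    module
  rw [h2, map_smul] at h1
  exact (smul_eq_zero_iff_right (by simp)).1 h1

theorem rep_algebraMap (z : ℂ) (f : V →ₗ[ℝ] ℂ) : L.rep (algebraMap ℂ ℍ[ℂ] z) f = z • f := by
  rw [AlgHom.commutes, Module.algebraMap_end_apply]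

variable {a b : Fin 2 → ℂ}

/-- Off the diagonal, the `+i`-eigenspace is the graph of a complex two-form. -/
theorem eigen_iff_of_cross_ne_zero (ha : a ≠ 0) (hb : b ≠ 0) (h : cross a b ≠ 0)
    (f k : V →ₗ[ℝ] ℂ) :
    L.rep (stereoQuat a + algebraMap ℂ ℍ[ℂ] Complex.I) (f + k) = 0 ∧
      L.rep (stereoQuat b + algebraMap ℂ ℍ[ℂ] Complex.I) (f - k) = 0 ↔
    k = -((Complex.I * cross a b)⁻¹ • L.rep (imQuat (sigmaCoeff a b)) f) := by
  set D := Complex.I * cross a b with hD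
  have hD0 : D ≠ 0 := mul_ne_zero Complex.I_ne_zero h
  set Θ := L.rep (imQuat (sigmaCoeff a b)) with hΘ
  constructor
  · rintro ⟨h1, h2⟩
    have k1 := rep_of_mul_sub_eq_zero (mul_stereoQuat_sub ha b) h1
    have k2 := rep_of_mul_sub_eq_zero (mul_stereoQuat_sub' hb a) h2
    rw [map_add L.rep, LinearMap.add_apply, rep_algebraMap, ← hD, ← hΘ] at k1
    rw [map_sub L.rep, LinearMap.sub_apply, rep_algebraMap, ← hD, ← hΘ] at k2
    simp only [map_add, map_sub] at k1 k2
    -- Half the difference of `(D + Θ)(f + k) = 0` and `(D - Θ)(f - k) = 0`.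
    have k3 : D • k + Θ f = 0 := by
      linear_combination (norm := module) (1 / 2 : ℂ) • k1 - (1 / 2 : ℂ) • k2
    rw [← inv_smul_smul₀ hD0 k, eq_neg_of_add_eq_zero_left k3, smul_neg]
  · rintro rfl
    -- For this `k` one has `f + k = (D - Θ)(D⁻¹ f)` and `f - k = (D + Θ)(D⁻¹ f)`.
    have k1 := rep_mul_apply_eq_zero (L := L) (stereoQuat_add_mul ha b) (D⁻¹ • f)
    have k2 := rep_mul_apply_eq_zero (L := L) (stereoQuat_add_mul' hb a) (D⁻¹ • f)
    rw [map_sub L.rep, LinearMap.sub_apply, rep_algebraMap, ← hD, ← hΘ, smul_inv_smul₀ hD0,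
      map_smul] at k1
    rw [map_add L.rep (algebraMap _ _ _) (imQuat _), LinearMap.add_apply, rep_algebraMap, ← hD,
      ← hΘ, smul_inv_smul₀ hD0, map_smul] at k2
    exact ⟨by rw [← sub_eq_add_neg, k1], by rw [sub_neg_eq_add, k2]⟩

theorem range_le_ker_of_cross_eq_zero (ha : a ≠ 0) (h : cross a b = 0) (f : V →ₗ[ℝ] ℂ) :
    L.rep (stereoQuat a + algebraMap ℂ ℍ[ℂ] Complex.I) (L.rep (imQuat (sigmaCoeff a b)) f) = 0 := by
  have := stereoQuat_add_mul ha b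
  rw [h, mul_zero, map_zero] at this
  exact rep_mul_apply_eq_zero (mul_eq_zero_of_mul_zero_sub this) f

theorem range_le_ker_of_cross_eq_zero' (hb : b ≠ 0) (h : cross a b = 0) (f : V →ₗ[ℝ] ℂ) :
    L.rep (stereoQuat b + algebraMap ℂ ℍ[ℂ] Complex.I) (L.rep (imQuat (sigmaCoeff a b)) f) = 0 := by
  have := stereoQuat_add_mul' hb a
  rw [h, mul_zero, map_zero, zero_add] at this
  exact rep_mul_apply_eq_zero this f

/-- On the diagonal, the `(1, 0)`-forms are the kernel of the holomorphic symplectic form. -/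
theorem stereoQuat_eigen_iff (ha : a ≠ 0) (hb : b ≠ 0) (h : cross a b = 0) (f : V →ₗ[ℝ] ℂ) :
    (L.rep (stereoQuat a + algebraMap ℂ ℍ[ℂ] Complex.I) f = 0 ↔
      L.rep (imQuat (sigmaCoeff a b)) f = 0) ∧
    (L.rep (stereoQuat b + algebraMap ℂ ℍ[ℂ] Complex.I) f = 0 ↔
      L.rep (imQuat (sigmaCoeff a b)) f = 0) ∧
    (L.rep (imQuat (sigmaCoeff a b)) f = 0 ↔
      f ∈ LinearMap.range (L.rep (imQuat (sigmaCoeff a b)))) := by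
  have h3 := mul_stereoQuat_sub ha b
  have h4 := mul_stereoQuat_sub' hb a
  rw [h, mul_zero, map_zero, zero_add] at h3
  rw [h, mul_zero, map_zero] at h4
  replace h4 : imQuat (sigmaCoeff a b) * (stereoQuat b - algebraMap ℂ ℍ[ℂ] Complex.I) = 0 :=
    mul_eq_zero_of_zero_sub_mul h4
  obtain ⟨r, hr⟩ := exists_anticommutator_eq_one (sigmaCoeff_ne_zero ha hb h)
  have key : L.rep (imQuat (sigmaCoeff a b)) f = 0 →
      L.rep (imQuat (sigmaCoeff a b)) (L.rep r f) = f := by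
    intro hf
    have := congrArg (fun x => L.rep x f) hr
    simpa [map_add, map_mul, hf] using this
  refine ⟨⟨fun hf => rep_of_mul_sub_eq_zero h3 hf, fun hf => ?_⟩,
    ⟨fun hf => rep_of_mul_sub_eq_zero h4 hf, fun hf => ?_⟩, fun hf => ⟨_, key hf⟩, ?_⟩
  · rw [← key hf]
    exact range_le_ker_of_cross_eq_zero ha h _
  · rw [← key hf]
    exact range_le_ker_of_cross_eq_zero' hb h _
  · rintro ⟨f, rfl⟩
    exact rep_of_mul_sub_eq_zero h3 (range_le_ker_of_cross_eq_zero ha h _)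

theorem eigen_iff_of_cross_eq_zero (ha : a ≠ 0) (hb : b ≠ 0) (h : cross a b = 0)
    (f k : V →ₗ[ℝ] ℂ) :
    L.rep (stereoQuat a + algebraMap ℂ ℍ[ℂ] Complex.I) (f + k) = 0 ∧
      L.rep (stereoQuat b + algebraMap ℂ ℍ[ℂ] Complex.I) (f - k) = 0 ↔
    L.rep (imQuat (sigmaCoeff a b)) f = 0 ∧ L.rep (imQuat (sigmaCoeff a b)) k = 0 := by
  rw [(stereoQuat_eigen_iff ha hb h _).1, (stereoQuat_eigen_iff ha hb h _).2.1, map_add, map_sub]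
  constructor
  · rintro ⟨h1, h2⟩
    constructor
    · linear_combination (norm := module) (1 / 2 : ℂ) • h1 + (1 / 2 : ℂ) • h2
    · linear_combination (norm := module) (1 / 2 : ℂ) • h1 - (1 / 2 : ℂ) • h2
  · rintro ⟨h1, h2⟩
    simp [h1, h2]

/-- Kernel and image coincide, so each has half the dimension `4n`. -/
theorem finrank_range_of_cross_eq_zero [T2Space V] {n : ℕ} (hn : Module.finrank ℝ V = 4 * n)
    (ha : a ≠ 0) (hb : b ≠ 0) (h : cross a b = 0) :
    Module.finrank ℂ (LinearMap.range (L.rep (imQuat (sigmaCoeff a b)) ∘ₗ L.flatComplex)) =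
      2 * n := by
  rw [LinearMap.range_comp_of_range_eq_top _ L.range_flatComplex]
  have h1 := LinearMap.finrank_range_add_finrank_ker (L.rep (imQuat (sigmaCoeff a b)))
  have h2 : LinearMap.ker (L.rep (imQuat (sigmaCoeff a b))) =
      LinearMap.range (L.rep (imQuat (sigmaCoeff a b))) := by
    ext f
    rw [LinearMap.mem_ker]
    exact (stereoQuat_eigen_iff ha hb h f).2.2
  rw [h2, finrank_covectors, hn] at h1
  omega

/-- The second complex structure governs `X + Y`, hence `f + k`. This is the source of the
interchange of the two factors between spinors and bi-Hermitian structures. -/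
theorem inEigen_iff [T2Space V] (ha : a ≠ 0) (hb : b ≠ 0) (X X' Y Y' : V) :
    InEigen (gualtieri L.g (L.cplx (stereo b)) (L.cplx (stereo a))) (X, L.g Y) (X', L.g Y') ↔
      L.rep (stereoQuat a + algebraMap ℂ ℍ[ℂ] Complex.I)
        (complexCovector (L.g X) (L.g X') + complexCovector (L.g Y) (L.g Y')) = 0 ∧
      L.rep (stereoQuat b + algebraMap ℂ ℍ[ℂ] Complex.I)
        (complexCovector (L.g X) (L.g X') - complexCovector (L.g Y) (L.g Y')) = 0 := by
  have e1 : complexCovector (L.g X) (L.g X') + complexCovector (L.g Y) (L.g Y') =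
      complexCovector (L.g (X + Y)) (L.g (X' + Y')) := by
    ext v
    simp [complexCovector_apply]
    ring
  have e2 : complexCovector (L.g X) (L.g X') - complexCovector (L.g Y) (L.g Y') =
      complexCovector (L.g (X - Y)) (L.g (X' - Y')) := by
    ext v
    simp [complexCovector_apply]
    ring
  rw [L.inEigen_gualtieri_iff (stereo_normSq hb) (stereo_normSq ha), e1, e2, stereoQuat, stereoQuat,
    L.rep_add_I_eq_zero_iff (stereo_normSq ha), L.rep_add_I_eq_zero_iff (stereo_normSq hb)]

theorem isPureSpinor_spinor [T2Space V] {n : ℕ} (hn : Module.finrank ℝ V = 4 * n)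
    (ha : a ≠ 0) (hb : b ≠ 0) :
    IsPureSpinor (gualtieri L.g (L.cplx (stereo b)) (L.cplx (stereo a))) (L.spinor n a b) := by
  have hB := L.isBivector_form (sigmaCoeff a b)
  -- Scalars do not affect the annihilator, so both cases reduce to the annihilator of the bare
  -- power or exponential, in terms of `f = g(X)` and `k`.
  have main : ∀ (c : ℂ) (φ : Forms V), c ≠ 0 → φ ≠ 0 → (∀ (X X' : V) (k : V →ₗ[ℝ] ℂ),
      CliffordAlgebra.contractLeft (evalComplex X X') φ + ExteriorAlgebra.ι ℂ k * φ = 0 ↔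
        L.rep (stereoQuat a + algebraMap ℂ ℍ[ℂ] Complex.I)
          (complexCovector (L.g X) (L.g X') + k) = 0 ∧
        L.rep (stereoQuat b + algebraMap ℂ ℍ[ℂ] Complex.I)
          (complexCovector (L.g X) (L.g X') - k) = 0) →
      IsPureSpinor (gualtieri L.g (L.cplx (stereo b)) (L.cplx (stereo a))) (c • φ) := by
    intro c φ hc hφ h
    refine ⟨smul_ne_zero hc hφ, ?_⟩
    rintro ⟨X, ξ⟩ ⟨X', ξ'⟩
    obtain ⟨Y, rfl⟩ := L.exists_eq_g ξ
    obtain ⟨Y', rfl⟩ := L.exists_eq_g ξ'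
    rw [inEigen_iff ha hb, ← h, cliffordAct_add_I_smul, map_smul, mul_smul_comm, ← smul_add,
      smul_eq_zero_iff_right hc]
  unfold spinor
  split_ifs with h
  · have hr := finrank_range_of_cross_eq_zero (L := L) hn ha hb h
    refine main _ _ (inv_ne_zero (Nat.cast_ne_zero.2 n.factorial_ne_zero)) ?_ fun X X' k => ?_
    · rw [Ne, hB.pow_eq_zero_iff, hr]
      omega
    · rw [hB.annihilator_pow hr, eigen_iff_of_cross_eq_zero ha hb h, LinearMap.comp_apply,
        flatComplex_evalComplex, LinearMap.range_comp_of_range_eq_top _ L.range_flatComplex,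
        ← (stereoQuat_eigen_iff ha hb h k).2.2]
  · have hD0 : Complex.I * cross a b ≠ 0 := mul_ne_zero Complex.I_ne_zero h
    have hB' := hB.smul (Complex.I * cross a b)⁻¹
    refine main _ _ (pow_ne_zero _ hD0) (IsNilpotent.isUnit_exp hB'.isNilpotent).ne_zero
      fun X X' k => ?_
    rw [hB'.annihilator_exp, eigen_iff_of_cross_ne_zero ha hb h, LinearMap.smul_apply,
      LinearMap.comp_apply, flatComplex_evalComplex]

end LinearHyperkahler

/-! ### The four-dimensional case -/

theorem twoVectors_le_exteriorPower {K E : Type*} [Field K] [AddCommGroup E] [Module K E] :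
    twoVectors K E ≤ ⋀[K]^2 E := by
  rw [twoVectors, Submodule.span_le]
  rintro _ ⟨a, b, rfl⟩
  change _ ∈ (LinearMap.range (ExteriorAlgebra.ι K)) ^ 2
  rw [pow_two]
  exact Submodule.mul_mem_mul ⟨a, rfl⟩ ⟨b, rfl⟩

theorem proj_exteriorPower_self {K E : Type*} [Field K] [AddCommGroup E] [Module K E] {k : ℕ}
    {x : ExteriorAlgebra K E} (hx : x ∈ ⋀[K]^k E) :
    GradedRing.proj (fun i : ℕ => ⋀[K]^i E) k x = x := by
  rw [GradedRing.proj_apply, DirectSum.decompose_of_mem_same (fun i : ℕ => ⋀[K]^i E) hx]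

theorem proj_exteriorPower_ne {K E : Type*} [Field K] [AddCommGroup E] [Module K E] {k m : ℕ}
    {x : ExteriorAlgebra K E} (hx : x ∈ ⋀[K]^k E) (h : k ≠ m) :
    GradedRing.proj (fun i : ℕ => ⋀[K]^i E) m x = 0 := by
  rw [GradedRing.proj_apply, DirectSum.decompose_of_mem_ne (fun i : ℕ => ⋀[K]^i E) hx h]

namespace LinearHyperkahler

variable {V : Type*} [AddCommGroup V] [Module ℝ V] [TopologicalSpace V]
  [IsTopologicalAddGroup V] [ContinuousSMul ℝ V] [FiniteDimensional ℝ V] (L : LinearHyperkahler V)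

/-- `c₀ ω_I + c₁ ω_J + c₂ ω_K + c₃ (1 - vol)`. -/
def mukaiElement (c : Fin 4 → ℂ) : Forms V :=
  L.form ![c 0, c 1, c 2] + c 3 • (1 - (1 / 2 : ℂ) • twoForm (L.kahler ![1, 0, 0]) ^ 2)

variable [T2Space V]

/-- On the conic `c₀² + c₁² + c₂² = 0` the form has rank two, so its square vanishes. A quadratic
map in three variables has six coefficients, and five points of the conic determine it up to a
multiple of the equation of the conic. -/
theorem form_sq_of_four (hV : Module.finrank ℝ V = 4) (c : Fin 3 → ℂ) :
    L.form c ^ 2 =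
      (c 0 ^ 2 + c 1 ^ 2 + c 2 ^ 2) • twoForm (L.kahler ![1, 0, 0]) ^ 2 := by
  have hsq : ∀ a : Fin 2 → ℂ, a ≠ 0 → L.form (sigmaCoeff a a) ^ 2 = 0 := by
    intro a ha
    have h : cross a a = 0 := by unfold cross; ring
    have hr := finrank_range_of_cross_eq_zero (L := L) (n := 1) (by simpa using hV) ha ha h
    rw [(L.isBivector_form _).pow_eq_zero_iff, hr]
    norm_num
  set A := twoForm (L.kahler ![1, 0, 0]) with hA
  set B := twoForm (L.kahler ![0, 1, 0]) with hB
  set C := twoForm (L.kahler ![0, 0, 1]) with hC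
  have cBA : B * A = A * B := commute_of_mem_twoVectors (L.isBivector_kahler _).mem _
  have cCA : C * A = A * C := commute_of_mem_twoVectors (L.isBivector_kahler _).mem _
  have cCB : C * B = B * C := commute_of_mem_twoVectors (L.isBivector_kahler _).mem _
  have expand (c : Fin 3 → ℂ) : L.form c ^ 2 = (c 0 ^ 2) • (A * A) + (c 1 ^ 2) • (B * B) +
      (c 2 ^ 2) • (C * C) + (2 * c 0 * c 1) • (A * B) + (2 * c 0 * c 2) • (A * C) +
      (2 * c 1 * c 2) • (B * C) := by
    rw [form, ← hA, ← hB, ← hC, pow_two]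
    simp only [add_mul, mul_add, smul_mul_assoc, mul_smul_comm, cBA, cCA, cCB]
    module
  have rel (x y : ℂ) (h : y ≠ 0 ∨ x ≠ 0) : (4 * x ^ 2 * y ^ 2) • (A * A) +
      ((y ^ 2 - x ^ 2) ^ 2) • (B * B) - ((y ^ 2 + x ^ 2) ^ 2) • (C * C) -
      (4 * x * y * (y ^ 2 - x ^ 2)) • (A * B) -
      (4 * x * y * (y ^ 2 + x ^ 2) * Complex.I) • (A * C) +
      (2 * (y ^ 2 - x ^ 2) * (y ^ 2 + x ^ 2) * Complex.I) • (B * C) = 0 := by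
    have e := hsq ![x, y] (fun h0 => by
      have h1 := congrFun h0 0
      have h2 := congrFun h0 1
      simp only [Matrix.cons_val, Pi.zero_apply] at h1 h2
      tauto)
    rw [expand] at e
    simp only [sigmaCoeff, Matrix.cons_val] at e
    have h2 : (Complex.I * (y * y + x * x)) ^ 2 = -(y ^ 2 + x ^ 2) ^ 2 := by
      rw [mul_pow, Complex.I_sq]; ring
    rw [h2] at e
    linear_combination (norm := module) e
  -- The five points: `0`, `∞`, `1`, `-1` and `2` in the affine coordinate.
  have e1 := rel 0 1 (by simp)
  have e2 := rel 1 0 (by simp)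
  have e3 := rel 1 1 (by simp)
  have e4 := rel (-1) 1 (by simp)
  have e5 := rel 2 1 (by simp)
  have hBC : B * C = 0 := by
    refine (smul_eq_zero_iff_right (by simp : (4 * Complex.I) ≠ 0)).1 ?_
    linear_combination (norm := module) e1 - e2
  have hBB : B * B = C * C := by
    linear_combination (norm := module) (1 / 2 : ℂ) • e1 + (1 / 2 : ℂ) • e2
  have hAC : A * C = 0 := by
    refine (smul_eq_zero_iff_right (by simp : (16 * Complex.I) ≠ 0)).1 ?_
    linear_combination (norm := module) e4 - e3
  have hAA : A * A = C * C := by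
    linear_combination (norm := module) (1 / 8 : ℂ) • e3 + (1 / 8 : ℂ) • e4
  have hAB : A * B = 0 := by
    refine (smul_eq_zero_iff_right (by simp : (24 : ℂ) ≠ 0)).1 ?_
    rw [hAC, hBC, hBB, hAA] at e5
    linear_combination (norm := module) e5
  rw [expand, hBC, hAC, hAB, hBB, pow_two A, hAA]
  module

/-- `I` is invertible, so `ω_I` has full rank four and its square survives. -/
theorem omegaI_sq_ne_zero (hV : Module.finrank ℝ V = 4) :
    twoForm (L.kahler ![1, 0, 0]) ^ 2 ≠ 0 := by
  have h := L.isBivector_kahler ![1, 0, 0]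
  rw [Ne, h.pow_eq_zero_iff, LinearMap.range_comp_of_range_eq_top _ L.range_flatComplex]
  have : LinearMap.range (L.rep (imQuat fun i => ((![1, 0, 0] : Fin 3 → ℝ) i : ℂ))) = ⊤ := by
    rw [LinearMap.range_eq_top]
    intro f
    refine ⟨-L.rep (imQuat fun i => ((![1, 0, 0] : Fin 3 → ℝ) i : ℂ)) f, ?_⟩
    ext v
    rw [map_neg, LinearMap.neg_apply, rep_imQuat_apply]
    simp [rep_imQuat_apply, L.II]
  rw [this, finrank_top, finrank_covectors, hV]
  norm_num

/-- In dimension four the cube of `θ / D` vanishes and its square is `-ω_I²`, because the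
coefficients of `θ` have sum of squares `-D²`. Hence `D exp (θ / D) = θ + D (1 - ω_I² / 2)`; on the
diagonal only `θ` remains. -/
theorem spinor_one_eq (hV : Module.finrank ℝ V = 4) (a b : Fin 2 → ℂ) :
    L.spinor 1 a b = L.mukaiElement (quadricPoint a b) := by
  have hvec : ![quadricPoint a b 0, quadricPoint a b 1, quadricPoint a b 2] = sigmaCoeff a b := rfl
  rw [mukaiElement, hvec, show quadricPoint a b 3 = Complex.I * cross a b from rfl]
  unfold spinor
  split_ifs with h
  · simp [h]
  · set D := Complex.I * cross a b with hD
    have hD0 : D ≠ 0 := mul_ne_zero Complex.I_ne_zero h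
    have hB := (L.isBivector_form (sigmaCoeff a b)).smul D⁻¹
    have h3 : (D⁻¹ • L.form (sigmaCoeff a b)) ^ 3 = 0 := by
      rw [hB.pow_eq_zero_iff]
      have := Submodule.finrank_le
        (LinearMap.range (D⁻¹ • (L.rep (imQuat (sigmaCoeff a b)) ∘ₗ L.flatComplex)))
      rw [finrank_covectors, hV] at this
      omega
    have hcoeff : sigmaCoeff a b 0 ^ 2 + sigmaCoeff a b 1 ^ 2 + sigmaCoeff a b 2 ^ 2 = -D ^ 2 := by
      simp only [sigmaCoeff, Matrix.cons_val, hD, cross, mul_pow, Complex.I_sq]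
      ring
    have h2 : (D⁻¹ • L.form (sigmaCoeff a b)) ^ 2 =
        -(twoForm (L.kahler ![1, 0, 0]) ^ 2) := by
      rw [smul_pow, L.form_sq_of_four hV, hcoeff, smul_smul, inv_pow, mul_neg,
        inv_mul_cancel₀ (pow_ne_zero 2 hD0), neg_one_smul]
    rw [IsNilpotent.exp_eq_sum h3]
    simp only [Finset.sum_range_succ, Finset.sum_range_zero, h2, pow_zero, pow_one, zero_add,
      Nat.factorial_zero, Nat.factorial_one, Nat.factorial_two, Nat.cast_one, inv_one, one_smul,
      smul_add, smul_inv_smul₀ hD0]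
    have hq (x : Forms V) : (((2 : ℕ) : ℚ)⁻¹) • x = (1 / 2 : ℂ) • x := by
      rw [← Rat.cast_smul_eq_qsmul ℂ]
      norm_num
    rw [hq]
    module

theorem mukai_mukaiElement (hV : Module.finrank ℝ V = 4) (c : Fin 4 → ℂ) :
    mukai (L.mukaiElement c) (L.mukaiElement c) =
      (c 0 ^ 2 + c 1 ^ 2 + c 2 ^ 2 + c 3 ^ 2) • twoForm (L.kahler ![1, 0, 0]) ^ 2 := by
  set Ω := twoForm (L.kahler ![1, 0, 0]) ^ 2 with hΩ
  have m2 : L.form ![c 0, c 1, c 2] ∈ ⋀[ℂ]^2 (V →ₗ[ℝ] ℂ) :=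
    twoVectors_le_exteriorPower (L.isBivector_form _).mem
  have m4 : Ω ∈ ⋀[ℂ]^4 (V →ₗ[ℝ] ℂ) :=
    SetLike.pow_mem_graded (A := fun i : ℕ => ⋀[ℂ]^i (V →ₗ[ℝ] ℂ)) 2
      (twoVectors_le_exteriorPower (L.isBivector_kahler _).mem)
  have m0 : (1 : Forms V) ∈ ⋀[ℂ]^0 (V →ₗ[ℝ] ℂ) :=
    SetLike.one_mem_graded (fun i : ℕ => ⋀[ℂ]^i (V →ₗ[ℝ] ℂ))
  have e : L.mukaiElement c = L.form ![c 0, c 1, c 2] + c 3 • (1 : Forms V) +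
      (-(c 3 / 2)) • Ω := by
    rw [mukaiElement]
    module
  have p2 : GradedRing.proj (fun i : ℕ => ⋀[ℂ]^i (V →ₗ[ℝ] ℂ)) 2 (L.mukaiElement c) =
      L.form ![c 0, c 1, c 2] := by
    rw [e, map_add, map_add, proj_exteriorPower_self m2,
      proj_exteriorPower_ne (Submodule.smul_mem _ _ m0) (by norm_num),
      proj_exteriorPower_ne (Submodule.smul_mem _ _ m4) (by norm_num), add_zero, add_zero]
  have p0 : GradedRing.proj (fun i : ℕ => ⋀[ℂ]^i (V →ₗ[ℝ] ℂ)) 0 (L.mukaiElement c) =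
      c 3 • (1 : Forms V) := by
    rw [e, map_add, map_add, proj_exteriorPower_ne m2 (by norm_num),
      proj_exteriorPower_self (Submodule.smul_mem _ _ m0),
      proj_exteriorPower_ne (Submodule.smul_mem _ _ m4) (by norm_num), zero_add, add_zero]
  have p4 : GradedRing.proj (fun i : ℕ => ⋀[ℂ]^i (V →ₗ[ℝ] ℂ)) 4 (L.mukaiElement c) =
      (-(c 3 / 2)) • Ω := by
    rw [e, map_add, map_add, proj_exteriorPower_ne m2 (by norm_num),
      proj_exteriorPower_ne (Submodule.smul_mem _ _ m0) (by norm_num),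
      proj_exteriorPower_self (Submodule.smul_mem _ _ m4), zero_add, zero_add]
  simp only [mukai, p0, p2, p4]
  rw [← pow_two, L.form_sq_of_four hV]
  simp only [smul_mul_assoc, mul_smul_comm, one_mul, mul_one, Matrix.cons_val, ← hΩ]
  module

theorem mukai_eq_zero_iff (hV : Module.finrank ℝ V = 4) (c : Fin 4 → ℂ) :
    mukai (L.mukaiElement c) (L.mukaiElement c) = 0 ↔
      c 0 ^ 2 + c 1 ^ 2 + c 2 ^ 2 + c 3 ^ 2 = 0 := by
  rw [L.mukai_mukaiElement hV, smul_eq_zero_iff_left (L.omegaI_sq_ne_zero hV)]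

end LinearHyperkahler

/-! ### The maps `rotationMap` and `quadricPoint` -/

theorem spherePoint_mk {a : Fin 2 → ℂ} (ha : a ≠ 0) :
    spherePoint (Projectivization.mk ℂ a ha) = stereo a := rfl

theorem spherePoint_normSq (ζ : CP1) :
    spherePoint ζ 0 ^ 2 + spherePoint ζ 1 ^ 2 + spherePoint ζ 2 ^ 2 = 1 := by
  induction ζ using Projectivization.ind with | h a ha => exact stereo_normSq ha

/-- The matrix is `√(1 + |η|²)` times an element of `SU(2)`, which acts on the sphere as a rotation;
the three vectors on the right are the images of the coordinate axes. -/
theorem stereo_rotation (η z w : ℂ) (h : z ≠ 0 ∨ w ≠ 0) (i : Fin 3) :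
    stereo ![z + η * w, -conj η * z + w] i =
      stereo ![z, w] 0 * stereo ![η, 1] i +
        stereo ![z, w] 1 * (Hyperkahler.sigmaPrimeCoeff η i).re +
        stereo ![z, w] 2 * (Hyperkahler.sigmaPrimeCoeff η i).im := by
  have hN : Complex.normSq (z + η * w) + Complex.normSq (-conj η * z + w) =
      (Complex.normSq z + Complex.normSq w) * (1 + Complex.normSq η) := by
    simp [Complex.normSq_apply]
    ring
  have h1 : Complex.normSq z + Complex.normSq w ≠ 0 := by
    refine normSq_add_ne_zero (a := ![z, w]) fun h0 => ?_
    have h1 := congrFun h0 0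
    have h2 := congrFun h0 1
    simp only [Matrix.cons_val, Pi.zero_apply] at h1 h2
    tauto
  have h2 : 1 + Complex.normSq η ≠ 0 := by
    have := Complex.normSq_nonneg η
    positivity
  have hS : (1 + Complex.normSq η : ℂ)⁻¹ = (((1 + Complex.normSq η)⁻¹ : ℝ) : ℂ) := by
    push_cast
    rfl
  have h3 : Complex.normSq η + 1 ≠ 0 := by rwa [add_comm]
  simp only [stereo, Hyperkahler.sigmaPrimeCoeff, Matrix.cons_val, Pi.smul_apply, smul_eq_mul, hN,
    hS, Complex.re_ofReal_mul, Complex.im_ofReal_mul, map_one]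
  rw [add_comm (Complex.normSq η) 1]
  fin_cases i <;> simp [pow_two] <;> field_simp <;> simp [Complex.normSq_apply] <;> ring

theorem stereo_neg_left (z w : ℂ) : stereo ![-z, w] =
    ![stereo ![z, w] 0, -stereo ![z, w] 1, -stereo ![z, w] 2] := by
  ext i
  fin_cases i <;> simp [stereo] <;> ring

/-- The second component is the same rotation applied to `-ζ`, and `ζ ↦ -ζ` is the half-turn about
the first axis. -/
theorem spherePoint_rotationMap (η : ℂ) (ζ : CP1) (i : Fin 3) :
    spherePoint (rotationMap η ζ).1 i = spherePoint ζ 0 * stereo ![η, 1] i +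
        (spherePoint ζ 1 * (Hyperkahler.sigmaPrimeCoeff η i).re +
        spherePoint ζ 2 * (Hyperkahler.sigmaPrimeCoeff η i).im) ∧
    spherePoint (rotationMap η ζ).2 i = spherePoint ζ 0 * stereo ![η, 1] i -
        (spherePoint ζ 1 * (Hyperkahler.sigmaPrimeCoeff η i).re +
        spherePoint ζ 2 * (Hyperkahler.sigmaPrimeCoeff η i).im) := by
  induction ζ using Projectivization.ind with | h a ha =>
  have hv (v : Fin 2 → ℂ) : ![v 0, v 1] = v := by ext i; fin_cases i <;> rfl
  have ha' : a 0 ≠ 0 ∨ a 1 ≠ 0 := by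
    by_contra! h
    exact ha (by ext i; fin_cases i <;> simp [h])
  have ha'' : -a 0 ≠ 0 ∨ a 1 ≠ 0 := by simpa using ha'
  rw [rotationMap, Projectivization.map_mk, Projectivization.map_mk, spherePoint_mk, spherePoint_mk,
    spherePoint_mk]
  have e1 : (!![1, η; -(1 * conj η), 1] : Matrix (Fin 2) (Fin 2) ℂ).mulVecLin a =
      ![a 0 + η * a 1, -conj η * a 0 + a 1] := by
    ext i
    fin_cases i <;> simp [Matrix.mulVec, dotProduct, Fin.sum_univ_two]
  have e2 : (!![-1, η; -(-1 * conj η), 1] : Matrix (Fin 2) (Fin 2) ℂ).mulVecLin a =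
      ![-a 0 + η * a 1, -conj η * -a 0 + a 1] := by
    ext i
    fin_cases i <;> simp [Matrix.mulVec, dotProduct, Fin.sum_univ_two]
  rw [e1, e2, stereo_rotation _ _ _ ha', stereo_rotation _ _ _ ha'', stereo_neg_left, hv a]
  simp only [Matrix.cons_val]
  constructor <;> ring

theorem sigmaPrimeCoeff_re_normSq (η : ℂ) : (Hyperkahler.sigmaPrimeCoeff η 0).re ^ 2 +
    (Hyperkahler.sigmaPrimeCoeff η 1).re ^ 2 + (Hyperkahler.sigmaPrimeCoeff η 2).re ^ 2 = 1 := by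
  have h2 : 1 + Complex.normSq η ≠ 0 := by
    have := Complex.normSq_nonneg η
    positivity
  have hS : (1 + Complex.normSq η : ℂ)⁻¹ = (((1 + Complex.normSq η)⁻¹ : ℝ) : ℂ) := by
    push_cast
    rfl
  simp only [Hyperkahler.sigmaPrimeCoeff, Matrix.cons_val, Pi.smul_apply, smul_eq_mul,
    hS, Complex.re_ofReal_mul]
  simp [pow_two]
  field_simp
  simp [Complex.normSq_apply]
  ring

theorem sigmaPrimeCoeff_im_normSq (η : ℂ) : (Hyperkahler.sigmaPrimeCoeff η 0).im ^ 2 +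
    (Hyperkahler.sigmaPrimeCoeff η 1).im ^ 2 + (Hyperkahler.sigmaPrimeCoeff η 2).im ^ 2 = 1 := by
  have h2 : 1 + Complex.normSq η ≠ 0 := by
    have := Complex.normSq_nonneg η
    positivity
  have hS : (1 + Complex.normSq η : ℂ)⁻¹ = (((1 + Complex.normSq η)⁻¹ : ℝ) : ℂ) := by
    push_cast
    rfl
  simp only [Hyperkahler.sigmaPrimeCoeff, Matrix.cons_val, Pi.smul_apply, smul_eq_mul,
    hS, Complex.im_ofReal_mul]
  simp [pow_two]
  field_simp
  simp [Complex.normSq_apply]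
  ring

/-- Half the sum of the two complex structures is the `I_η` term, which fills the diagonal blocks;
half the difference consists of the two symplectic terms, which fill the others. The inverse forms
add up because `inverse_apply` makes them linear in the coefficients. -/
theorem LinearHyperkahler.rotation_eq {V : Type*} [AddCommGroup V] [Module ℝ V]
    [TopologicalSpace V] [IsTopologicalAddGroup V] [ContinuousSMul ℝ V] [FiniteDimensional ℝ V]
    [T2Space V] (L : LinearHyperkahler V) (η : ℂ) (ζ : CP1) :
    spherePoint ζ 0 • genOfComplex (L.cplx (stereo ![η, 1])) +
      spherePoint ζ 1 • genOfSymplectic (L.kahler fun i => (Hyperkahler.sigmaPrimeCoeff η i).re) +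
      spherePoint ζ 2 • genOfSymplectic (L.kahler fun i => (Hyperkahler.sigmaPrimeCoeff η i).im) =
    gualtieri L.g (L.cplx (spherePoint (rotationMap η ζ).1))
      (L.cplx (spherePoint (rotationMap η ζ).2)) := by
  refine LinearMap.ext fun ⟨X, ξ⟩ => ?_
  obtain ⟨Y, rfl⟩ := L.exists_eq_g ξ
  have h1 (X : V) : L.cplx (spherePoint (rotationMap η ζ).1) X =
      spherePoint ζ 0 • L.cplx (stereo ![η, 1]) X +
        (spherePoint ζ 1 • L.cplx (fun i => (Hyperkahler.sigmaPrimeCoeff η i).re) X +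
        spherePoint ζ 2 • L.cplx (fun i => (Hyperkahler.sigmaPrimeCoeff η i).im) X) := by
    simp only [cplx_apply, (spherePoint_rotationMap η ζ _).1]
    module
  have h2 (X : V) : L.cplx (spherePoint (rotationMap η ζ).2) X =
      spherePoint ζ 0 • L.cplx (stereo ![η, 1]) X -
        (spherePoint ζ 1 • L.cplx (fun i => (Hyperkahler.sigmaPrimeCoeff η i).re) X +
        spherePoint ζ 2 • L.cplx (fun i => (Hyperkahler.sigmaPrimeCoeff η i).im) X) := by
    simp only [cplx_apply, (spherePoint_rotationMap η ζ _).2]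
    module
  rw [L.gualtieri_apply (spherePoint_normSq _) (spherePoint_normSq _)]
  simp only [LinearMap.add_apply, LinearMap.smul_apply, L.genOfComplex_apply,
    L.genOfSymplectic_apply (c := fun i => (Hyperkahler.sigmaPrimeCoeff η i).re)
      (sigmaPrimeCoeff_re_normSq η),
    L.genOfSymplectic_apply (c := fun i => (Hyperkahler.sigmaPrimeCoeff η i).im)
      (sigmaPrimeCoeff_im_normSq η), h1, h2, Prod.smul_mk, Prod.mk_add_mk]
  rw [Prod.mk.injEq]
  refine ⟨by module, ?_⟩
  simp only [map_smul, map_add, map_sub, map_neg]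
  module

theorem rotationMap_mk (η : ℂ) (z w : ℂ) (h : ![z, w] ≠ 0) {a b : Fin 2 → ℂ} (ha : a ≠ 0)
    (hb : b ≠ 0) (s t : ℂ) (h0 : z + η * w = s * a 0) (h1 : -conj η * z + w = s * a 1)
    (k0 : -z + η * w = t * b 0) (k1 : conj η * z + w = t * b 1) :
    rotationMap η (Projectivization.mk ℂ ![z, w] h) =
      (Projectivization.mk ℂ a ha, Projectivization.mk ℂ b hb) := by
  rw [rotationMap, Projectivization.map_mk, Projectivization.map_mk, Prod.mk.injEq,
    Projectivization.mk_eq_mk_iff', Projectivization.mk_eq_mk_iff']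
  refine ⟨⟨s, ?_⟩, ⟨t, ?_⟩⟩
  · ext i
    fin_cases i <;> simp [Matrix.mulVec, dotProduct, Fin.sum_univ_two, ← h0, ← h1]
  · ext i
    fin_cases i <;> simp [Matrix.mulVec, dotProduct, Fin.sum_univ_two, ← k0, ← k1]

theorem exists_phase (h : ℂ) : ∃ u : ℂ, u * conj u = 1 ∧ conj (conj u * h) = conj u * h := by
  by_cases hh : h = 0
  · exact ⟨1, by simp, by simp [hh]⟩
  · have hn : (‖h‖ : ℂ) ≠ 0 := by simpa using hh
    have hc : h * conj h = (‖h‖ : ℂ) ^ 2 := by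
      rw [Complex.mul_conj, Complex.normSq_eq_norm_sq]
      push_cast
      rfl
    refine ⟨h / ‖h‖, ?_, ?_⟩
    · simp
      field_simp
      rw [hc]
    · simp
      ring

/-- Rescale representatives until `a + u b` is Hermitian orthogonal to `a - u b`. Then `a + u b`
represents a midpoint of the two points of the sphere, and `η` is its affine coordinate. -/
theorem rotationMap_surjective (p : CP1 × CP1) : ∃ (η : ℂ) (ζ : CP1), rotationMap η ζ = p := by
  obtain ⟨α, β⟩ := p
  induction α using Projectivization.ind with | h a ha =>
  induction β using Projectivization.ind with | h b hb =>
  have hmid : ∀ u : ℂ, u ≠ 0 → a 1 + u * b 1 ≠ 0 →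
      (a 0 + u * b 0) * conj (a 0 - u * b 0) + (a 1 + u * b 1) * conj (a 1 - u * b 1) = 0 →
      ∃ (η : ℂ) (ζ : CP1), rotationMap η ζ =
        (Projectivization.mk ℂ a ha, Projectivization.mk ℂ b hb) := by
    intro u hu hm h
    have hm' : conj (a 1 + u * b 1) ≠ 0 := by simpa only [ne_eq, map_eq_zero] using hm
    have h' : conj (a 0 + u * b 0) * (a 0 - u * b 0) +
        conj (a 1 + u * b 1) * (a 1 - u * b 1) = 0 := by
      have := congrArg conj h
      simpa only [map_add, map_mul, Complex.conj_conj, map_sub, map_zero] using this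
    have hη : conj ((a 0 + u * b 0) / (a 1 + u * b 1)) * (a 0 - u * b 0) = -(a 1 - u * b 1) := by
      rw [map_div₀, div_mul_eq_mul_div, div_eq_iff hm']
      linear_combination h'
    -- Orthogonality says `η̄ (a₀ - u b₀) = -(a₁ - u b₁)`, so the two images of this `ζ` are `2 a`
    -- and `2 u b`.
    refine ⟨(a 0 + u * b 0) / (a 1 + u * b 1),
      Projectivization.mk ℂ ![a 0 - u * b 0, a 1 + u * b 1] (fun h0 => hm (congrFun h0 1)),
      rotationMap_mk _ _ _ _ ha hb 2 (2 * u) ?_ ?_ ?_ ?_⟩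
    · rw [div_mul_cancel₀ _ hm]; ring
    · linear_combination -hη
    · rw [div_mul_cancel₀ _ hm]; ring
    · linear_combination hη
  obtain ⟨w, hw, hw'⟩ := exists_phase (a 0 * conj (b 0) + a 1 * conj (b 1))
  -- The modulus makes `a` and `u b` equally long, and the phase `w` makes their Hermitian product
  -- real; together these give the orthogonality, for `u = ρ w` and for `u = -ρ w`.
  set ρ : ℝ := Real.sqrt ((Complex.normSq (a 0) + Complex.normSq (a 1)) /
    (Complex.normSq (b 0) + Complex.normSq (b 1))) with hρ
  have hpos {v : Fin 2 → ℂ} (hv : v ≠ 0) : 0 < Complex.normSq (v 0) + Complex.normSq (v 1) :=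
    lt_of_le_of_ne (add_nonneg (Complex.normSq_nonneg _) (Complex.normSq_nonneg _))
      (normSq_add_ne_zero hv).symm
  have hρ0 : ρ ≠ 0 := (Real.sqrt_pos.2 (div_pos (hpos ha) (hpos hb))).ne'
  have hρ2 : (ρ : ℂ) ^ 2 * (b 0 * conj (b 0) + b 1 * conj (b 1)) =
      a 0 * conj (a 0) + a 1 * conj (a 1) := by
    have : ρ ^ 2 * (Complex.normSq (b 0) + Complex.normSq (b 1)) =
        Complex.normSq (a 0) + Complex.normSq (a 1) := by
      rw [hρ, Real.sq_sqrt (div_pos (hpos ha) (hpos hb)).le, div_mul_cancel₀ _ (hpos hb).ne']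
    simp only [Complex.mul_conj]
    exact_mod_cast this
  have hw0 : w ≠ 0 := by
    rintro rfl
    simp at hw
  have hu0 : (ρ : ℂ) * w ≠ 0 := mul_ne_zero (by exact_mod_cast hρ0) hw0
  simp only [map_mul, map_add, Complex.conj_conj] at hw'
  have horth (s : ℂ) (hs : s = 1 ∨ s = -1) :
      (a 0 + s * (ρ * w) * b 0) * conj (a 0 - s * (ρ * w) * b 0) +
        (a 1 + s * (ρ * w) * b 1) * conj (a 1 - s * (ρ * w) * b 1) = 0 := by
    rcases hs with rfl | rfl <;>
      simp only [map_sub, map_mul, Complex.conj_ofReal, map_one, map_neg]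
    · linear_combination -hρ2 + ρ * hw' -
        (ρ : ℂ) ^ 2 * (b 0 * conj (b 0) + b 1 * conj (b 1)) * hw
    · linear_combination -hρ2 - ρ * hw' -
        (ρ : ℂ) ^ 2 * (b 0 * conj (b 0) + b 1 * conj (b 1)) * hw
  -- The two signs of `u` give two midpoints, and one with finite `η` is needed. If both are `∞`,
  -- then `α = β = ∞`, which is reached from `η = 0`, `ζ = ∞`.
  by_cases h1 : a 1 + 1 * (ρ * w) * b 1 = 0
  · by_cases h2 : a 1 + -1 * (ρ * w) * b 1 = 0
    · have ha1 : a 1 = 0 := by linear_combination (h1 + h2) / 2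
      have hb1 : b 1 = 0 := by
        have : (ρ * w) * b 1 = 0 := by linear_combination (h1 - h2) / 2
        exact (mul_eq_zero.1 this).resolve_left hu0
      have ha0 : a 0 ≠ 0 := fun h => ha (by ext i; fin_cases i <;> simp [h, ha1])
      have hb0 : b 0 ≠ 0 := fun h => hb (by ext i; fin_cases i <;> simp [h, hb1])
      refine ⟨0, Projectivization.mk ℂ ![1, 0] (by simp), rotationMap_mk _ _ _ _ ha hb
        (a 0)⁻¹ (-(b 0)⁻¹) ?_ ?_ ?_ ?_⟩ <;> simp [ha0, hb0, ha1, hb1]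
    · exact hmid (-1 * (ρ * w)) (by simpa using hu0) h2 (horth _ (Or.inr rfl))
  · exact hmid (1 * (ρ * w)) (by simpa using hu0) h1 (horth _ (Or.inl rfl))

theorem sum_sq_quadricPoint (a b : Fin 2 → ℂ) : quadricPoint a b 0 ^ 2 + quadricPoint a b 1 ^ 2 +
    quadricPoint a b 2 ^ 2 + quadricPoint a b 3 ^ 2 = 0 := by
  simp only [quadricPoint, Matrix.cons_val, mul_pow, Complex.I_sq]
  ring

/-- The equation of the quadric says that the matrix `m` of the would-be products `a i * b j` has
determinant zero. A nonzero singular two-by-two matrix is a column times a row, both read off at a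
nonzero entry. -/
theorem exists_quadricPoint {c : Fin 4 → ℂ} (hc : c ≠ 0)
    (h : c 0 ^ 2 + c 1 ^ 2 + c 2 ^ 2 + c 3 ^ 2 = 0) :
    ∃ a b : Fin 2 → ℂ, a ≠ 0 ∧ b ≠ 0 ∧ c = quadricPoint a b := by
  have hI := Complex.I_mul_I
  set m : Fin 2 → Fin 2 → ℂ := ![![-(c 1 + Complex.I * c 2) / 2, -(c 0 + Complex.I * c 3) / 2],
    ![-(c 0 - Complex.I * c 3) / 2, (c 1 - Complex.I * c 2) / 2]] with hm
  have hdet : m 0 0 * m 1 1 = m 0 1 * m 1 0 := by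
    simp only [hm, Matrix.cons_val]
    linear_combination -h / 4 + (c 2 ^ 2 + c 3 ^ 2) / 4 * hI
  have hc' : c = ![-(m 0 1 + m 1 0), m 1 1 - m 0 0, Complex.I * (m 1 1 + m 0 0),
      Complex.I * (m 0 1 - m 1 0)] := by
    ext i
    fin_cases i <;> simp [hm]
    · ring
    · ring
    · linear_combination c 2 * hI
    · linear_combination c 3 * hI
  obtain ⟨i, j, hij⟩ : ∃ i j, m i j ≠ 0 := by
    by_contra! h0
    rw [hc'] at hc
    simp [h0] at hc
  have hr : ∀ k l, m k j / m i j * m i l = m k l := by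
    intro k l
    rw [div_mul_eq_mul_div, div_eq_iff hij]
    fin_cases i <;> fin_cases j <;> fin_cases k <;> fin_cases l <;>
      simp only [Fin.zero_eta, Fin.mk_one] at hdet ⊢ <;>
      first | ring1 | linear_combination hdet | linear_combination -hdet
  refine ⟨fun k => m k j / m i j, m i, ?_, ?_, ?_⟩
  · exact fun h0 => by simpa [hij] using congrFun h0 i
  · exact fun h0 => hij (congrFun h0 j)
  · simp only [quadricPoint, hr]
    exact hc'

theorem mk_eq_mk_of_mul_eq {a b a' b' : Fin 2 → ℂ} (ha : a ≠ 0) (ha' : a' ≠ 0) (hb : b ≠ 0)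
    (h : ∀ i j, a i * b j = a' i * b' j) :
    Projectivization.mk ℂ a ha = Projectivization.mk ℂ a' ha' := by
  obtain ⟨j, hj⟩ := Function.ne_iff.1 hb
  rw [Projectivization.mk_eq_mk_iff']
  refine ⟨b' j / b j, ?_⟩
  ext i
  have := h i j
  simp only [Pi.zero_apply] at hj
  simp only [Pi.smul_apply, smul_eq_mul]
  field_simp
  linear_combination -this

theorem quadric_iff_existsUnique {c : Fin 4 → ℂ} (hc : c ≠ 0) :
    c 0 ^ 2 + c 1 ^ 2 + c 2 ^ 2 + c 3 ^ 2 = 0 ↔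
      ∃! p : CP1 × CP1, ∃ (a b : Fin 2 → ℂ) (ha : a ≠ 0) (hb : b ≠ 0),
        p = (Projectivization.mk ℂ a ha, Projectivization.mk ℂ b hb) ∧ c = quadricPoint a b := by
  constructor
  · intro h
    obtain ⟨a, b, ha, hb, hq⟩ := exists_quadricPoint hc h
    refine ⟨_, ⟨a, b, ha, hb, rfl, hq⟩, ?_⟩
    rintro _ ⟨a', b', ha', hb', rfl, hq'⟩
    have hprod : ∀ i j, a' i * b' j = a i * b j := by
      obtain ⟨k0, k1, k2, k3⟩ := quadricPoint_products a b
      obtain ⟨l0, l1, l2, l3⟩ := quadricPoint_products a' b'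
      rw [← hq] at k0 k1 k2 k3
      rw [← hq'] at l0 l1 l2 l3
      intro i j
      fin_cases i <;> fin_cases j
      exacts [l0.trans k0.symm, l2.trans k2.symm, l3.trans k3.symm, l1.trans k1.symm]
    exact Prod.ext (mk_eq_mk_of_mul_eq ha' ha hb' hprod)
      (mk_eq_mk_of_mul_eq hb' hb ha' fun i j => by
        rw [mul_comm, hprod, mul_comm])
  · rintro ⟨_, ⟨a, b, _, _, _, rfl⟩, _⟩
    exact sum_sq_quadricPoint a b

/-! ### The pointwise results on the tangent spaces of the manifold. -/

section Pointwise

variable {n : ℕ} {M : Type*} [TopologicalSpace M] [ChartedSpace (Model n) M]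
  [IsManifold 𝓘(ℝ, Model n) ∞ M]

instance (x : M) : T2Space (𝕋 n x) := inferInstanceAs (T2Space (Model n))

theorem finrank_tangentSpace (x : M) : Module.finrank ℝ (𝕋 n x) = 4 * n :=
  finrank_euclideanSpace_fin (𝕜 := ℝ) (n := 4 * n)

theorem IsKahler.skew {g : Metric n M} {A : ∀ x : M, 𝕋 n x →L[ℝ] 𝕋 n x} (h : IsKahler g A)
    (x : M) (u v : 𝕋 n x) : g.inner x (A x u) v = -g.inner x u (A x v) := by
  rw [← h.hermitian x u, h.sq, map_neg, neg_neg]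

namespace Hyperkahler

variable (H : Hyperkahler n M)

/-- The hyperkähler structure on a tangent space. -/
def linear (x : M) : LinearHyperkahler (𝕋 n x) where
  g := H.g.inner x
  I := H.I x
  J := H.J x
  K := H.K x
  symm := H.g.symm x
  pos := H.g.pos x
  II := H.kahler_I.sq x
  JJ := H.kahler_J.sq x
  KK := H.kahler_K.sq x
  IJ := H.IJ x
  JI := H.JI x
  JK := H.JK x
  KJ := H.KJ x
  KI := H.KI x
  IK := H.IK x
  skew_I := H.kahler_I.skew x
  skew_J := H.kahler_J.skew x
  skew_K := H.kahler_K.skew x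

theorem rotationSpinor_eq (a b : Fin 2 → ℂ) (x : M) :
    H.rotationSpinor a b x = (H.linear x).spinor n a b := by
  have h : (a 1 * b 1) • H.sigma x - (a 0 * b 1 + a 1 * b 0) • H.omegaI x -
      (a 0 * b 0) • H.sigmaBar x = (H.linear x).form (sigmaCoeff a b) := by
    change (a 1 * b 1) • (H.omegaJ x + Complex.I • H.omegaK x) -
      (a 0 * b 1 + a 1 * b 0) • H.omegaI x - (a 0 * b 0) • (H.omegaJ x - Complex.I • H.omegaK x) =
      sigmaCoeff a b 0 • H.omegaI x + sigmaCoeff a b 1 • H.omegaJ x + sigmaCoeff a b 2 • H.omegaK x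
    simp only [sigmaCoeff, Matrix.cons_val]
    module
  unfold rotationSpinor LinearHyperkahler.spinor
  rw [h]
  rfl

theorem mukaiElement_eq (c : Fin 4 → ℂ) (x : M) :
    H.mukaiElement c x = (H.linear x).mukaiElement c := rfl

theorem rotation_eq_biHermitian (η : ℂ) (ζ : CP1) :
    H.rotation η ζ = H.biHermitian (rotationMap η ζ).1 (rotationMap η ζ).2 :=
  funext fun x => (H.linear x).rotation_eq η ζ

theorem isPureSpinor_rotationSpinor {a b : Fin 2 → ℂ} (ha : a ≠ 0) (hb : b ≠ 0) (x : M) :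
    IsPureSpinor (H.biHermitian (Projectivization.mk ℂ b hb) (Projectivization.mk ℂ a ha) x)
      (H.rotationSpinor a b x) := by
  rw [rotationSpinor_eq]
  exact (H.linear x).isPureSpinor_spinor (finrank_tangentSpace x) ha hb

end Hyperkahler

/-- For every real `u` the vector `u - i S u` lies in the `+i`-eigenspace of `S`, hence annihilates
the spinor, hence lies in that of `T`; its real part then gives `T u = S u`. -/
theorem IsPureSpinor.unique {V : Type*} [AddCommGroup V] [Module ℝ V] [TopologicalSpace V]
    [IsTopologicalAddGroup V] [ContinuousSMul ℝ V]
    {S T : (V × (V →L[ℝ] ℝ)) →ₗ[ℝ] (V × (V →L[ℝ] ℝ))} {φ : Forms V} (hS : IsPureSpinor S φ)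
    (hT : IsPureSpinor T φ) (h : ∀ u, S (S u) = -u) : S = T := by
  refine LinearMap.ext fun u => ?_
  have h1 : InEigen S u (-S u) := ⟨(neg_neg _).symm, by rw [map_neg, h, neg_neg]⟩
  rw [((hT.2 u _).1 ((hS.2 u _).2 h1)).1, neg_neg]

end Pointwise

/-! ### Smoothness of the inverse of a bundle isomorphism. -/

section BundleInverse

variable {𝕜 B F₁ F₂ : Type*} [NontriviallyNormedField 𝕜] {n : WithTop ℕ∞}
  {E₁ : B → Type*}
  [∀ x, AddCommGroup (E₁ x)] [∀ x, Module 𝕜 (E₁ x)] [NormedAddCommGroup F₁] [NormedSpace 𝕜 F₁]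
  [TopologicalSpace (TotalSpace F₁ E₁)] [∀ x, TopologicalSpace (E₁ x)]
  {E₂ : B → Type*} [∀ x, AddCommGroup (E₂ x)]
  [∀ x, Module 𝕜 (E₂ x)] [NormedAddCommGroup F₂] [NormedSpace 𝕜 F₂]
  [TopologicalSpace (TotalSpace F₂ E₂)] [∀ x, TopologicalSpace (E₂ x)]
  {EB : Type*} [NormedAddCommGroup EB] [NormedSpace 𝕜 EB] {HB : Type*} [TopologicalSpace HB]
  {IB : ModelWithCorners 𝕜 EB HB} [TopologicalSpace B] [ChartedSpace HB B]
  [FiberBundle F₁ E₁] [VectorBundle 𝕜 F₁ E₁] [FiberBundle F₂ E₂] [VectorBundle 𝕜 F₂ E₂]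
  [∀ x, IsTopologicalAddGroup (E₁ x)] [∀ x, ContinuousSMul 𝕜 (E₁ x)]
  [∀ x, IsTopologicalAddGroup (E₂ x)] [∀ x, ContinuousSMul 𝕜 (E₂ x)] [CompleteSpace F₁]

/-- A section of a vector bundle is smooth if its image under a smooth bundle isomorphism is. -/
theorem contMDiffAt_of_clm_bundle_apply {x : B} (ϕ : ∀ x, E₁ x ≃L[𝕜] E₂ x) {v : ∀ x, E₁ x}
    (hϕ : ContMDiffAt IB (IB.prod 𝓘(𝕜, F₁ →L[𝕜] F₂)) n
      (fun m ↦ TotalSpace.mk' (F₁ →L[𝕜] F₂) (E := fun (x : B) ↦ (E₁ x →L[𝕜] E₂ x)) m (ϕ m)) x)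
    (hv : ContMDiffAt IB (IB.prod 𝓘(𝕜, F₂)) n (fun m ↦ TotalSpace.mk' F₂ m (ϕ m (v m))) x) :
    ContMDiffAt IB (IB.prod 𝓘(𝕜, F₁)) n (fun m ↦ TotalSpace.mk' F₁ m (v m)) x := by
  have h1 : x ∈ (trivializationAt F₁ E₁ x).baseSet := FiberBundle.mem_baseSet_trivializationAt' x
  have h2 : x ∈ (trivializationAt F₂ E₂ x).baseSet := FiberBundle.mem_baseSet_trivializationAt' x
  rw [contMDiffAt_hom_bundle] at hϕ
  have hinv : ContMDiffAt IB (IB.prod 𝓘(𝕜, F₂ →L[𝕜] F₁)) n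
      (fun m ↦ TotalSpace.mk' (F₂ →L[𝕜] F₁) (E := fun (x : B) ↦ (E₂ x →L[𝕜] E₁ x)) m
        ((ϕ m).symm : E₂ m →L[𝕜] E₁ m)) x := by
    rw [contMDiffAt_hom_bundle]
    refine ⟨contMDiffAt_id, ?_⟩
    have e : ∀ y (hy1 : y ∈ (trivializationAt F₁ E₁ x).baseSet)
        (hy2 : y ∈ (trivializationAt F₂ E₂ x).baseSet),
        ContinuousLinearMap.inCoordinates F₁ E₁ F₂ E₂ x y x y (ϕ y : E₁ y →L[𝕜] E₂ y) =
        ((((trivializationAt F₁ E₁ x).continuousLinearEquivAt 𝕜 y hy1).symm.trans (ϕ y)).trans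
          ((trivializationAt F₂ E₂ x).continuousLinearEquivAt 𝕜 y hy2) : F₁ →L[𝕜] F₂) := by
      intro y hy1 hy2
      rw [ContinuousLinearMap.inCoordinates_eq hy1 hy2]
      rfl
    -- In local trivialisations the claim is that inversion of operators is smooth at an invertible
    -- one.
    have hd := contDiffAt_map_inverse (𝕜 := 𝕜) (n := n)
      ((((trivializationAt F₁ E₁ x).continuousLinearEquivAt 𝕜 x h1).symm.trans (ϕ x)).trans
          ((trivializationAt F₂ E₂ x).continuousLinearEquivAt 𝕜 x h2))
    rw [← e x h1 h2] at hd
    have hc := hd.contMDiffAt.comp x hϕ.2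
    refine hc.congr_of_eventuallyEq ?_
    filter_upwards [(trivializationAt F₁ E₁ x).open_baseSet.mem_nhds h1,
      (trivializationAt F₂ E₂ x).open_baseSet.mem_nhds h2] with y hy1 hy2
    simp only [Function.comp_apply]
    rw [e y hy1 hy2, ContinuousLinearMap.inverse_equiv,
      ContinuousLinearMap.inCoordinates_eq hy2 hy1]
    rfl
  have := hinv.clm_bundle_apply hv
  simpa using this

end BundleInverse

/-! ### Smoothness of sections and of the musical isomorphism. -/

section Smooth

variable {n : ℕ} {M : Type*} [TopologicalSpace M] [ChartedSpace (Model n) M]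
  [IsManifold 𝓘(ℝ, Model n) ∞ M]

theorem SmoothVF.add {X Y : ∀ x : M, 𝕋 n x} (hX : SmoothVF X) (hY : SmoothVF Y) :
    SmoothVF (fun x => X x + Y x) := ContMDiff.add_section hX hY

theorem SmoothVF.const_smul {X : ∀ x : M, 𝕋 n x} (r : ℝ) (hX : SmoothVF X) :
    SmoothVF (fun x => r • X x) := ContMDiff.const_smul_section hX

theorem SmoothEnd.apply {A : ∀ x : M, 𝕋 n x →L[ℝ] 𝕋 n x} {X : ∀ x : M, 𝕋 n x}
    (hA : SmoothEnd A) (hX : SmoothVF X) : SmoothVF (fun x => A x (X x)) :=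
  ContMDiff.clm_bundle_apply hA hX

theorem SmoothVFAt.add {X Y : ∀ x : M, 𝕋 n x} {x : M} (hX : SmoothVFAt X x)
    (hY : SmoothVFAt Y x) : SmoothVFAt (fun x => X x + Y x) x := ContMDiffAt.add_section hX hY

theorem SmoothVFAt.const_smul {X : ∀ x : M, 𝕋 n x} {x : M} (r : ℝ) (hX : SmoothVFAt X x) :
    SmoothVFAt (fun x => r • X x) x := ContMDiffAt.const_smul_section hX

theorem SmoothEnd.applyAt {A : ∀ x : M, 𝕋 n x →L[ℝ] 𝕋 n x} {X : ∀ x : M, 𝕋 n x} {x : M}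
    (hA : SmoothEnd A) (hX : SmoothVFAt X x) : SmoothVFAt (fun x => A x (X x)) x :=
  ContMDiffAt.clm_bundle_apply (hA x) hX

theorem smoothOneForm_inner (g : Metric n M) {X : ∀ x : M, 𝕋 n x} (hX : SmoothVF X) :
    SmoothOneForm (fun x => g.inner x (X x)) :=
  ContMDiff.clm_bundle_apply (F₁ := Model n) (F₂ := Model n →L[ℝ] ℝ) (E₁ := 𝕋 n)
    (E₂ := fun x : M => 𝕋 n x →L[ℝ] Bundle.Trivial M ℝ x) g.contMDiff hX

/-- The vector field dual to a smooth one-form. -/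
theorem smoothVF_of_inner (g : Metric n M) {X : ∀ x : M, 𝕋 n x}
    (e : ∀ x : M, 𝕋 n x ≃ₗ[ℝ] (𝕋 n x →L[ℝ] ℝ)) (he : ∀ x u, e x u = g.inner x u)
    (h : SmoothOneForm (fun x => g.inner x (X x))) : SmoothVF X := by
  intro x
  have hg := g.contMDiff x
  have e' : ∀ x, g.inner x = ((e x).toContinuousLinearEquiv : 𝕋 n x →L[ℝ] (𝕋 n x →L[ℝ] ℝ)) :=
    fun x => ContinuousLinearMap.ext fun u => (he x u).symm
  refine contMDiffAt_of_clm_bundle_apply (F₁ := Model n) (F₂ := Model n →L[ℝ] ℝ) (E₁ := 𝕋 n)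
    (E₂ := fun x : M => 𝕋 n x →L[ℝ] Bundle.Trivial M ℝ x)
    (fun x => (e x).toContinuousLinearEquiv) ?_ ?_
  · convert! hg using 3
    exact (e' _).symm
  · convert! h x using 3
    exact he _ _

end Smooth

/-! ### The eigenspaces in terms of real two-forms and complex structures. -/

namespace LinearHyperkahler

variable {V : Type*} [AddCommGroup V] [Module ℝ V] [TopologicalSpace V]
  [IsTopologicalAddGroup V] [ContinuousSMul ℝ V] [FiniteDimensional ℝ V] [T2Space V]
  (L : LinearHyperkahler V)

/-- Off the diagonal, the `+i`-eigenspace is the graph of minus a complex two-form. -/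
theorem inEigen_iff_of_cross_ne_zero {a b : Fin 2 → ℂ} (ha : a ≠ 0) (hb : b ≠ 0)
    (h : cross a b ≠ 0) {c : Fin 3 → ℂ} (hc : c = (Complex.I * cross a b)⁻¹ • sigmaCoeff a b)
    (X X' : V) (ξ ξ' : V →L[ℝ] ℝ) :
    InEigen (gualtieri L.g (L.cplx (stereo b)) (L.cplx (stereo a))) (X, ξ) (X', ξ') ↔
      ξ = -(L.kahler (fun i => (c i).re) X - L.kahler (fun i => (c i).im) X') ∧
      ξ' = -(L.kahler (fun i => (c i).re) X' + L.kahler (fun i => (c i).im) X) := by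
  obtain ⟨Y, rfl⟩ := L.exists_eq_g ξ
  obtain ⟨Y', rfl⟩ := L.exists_eq_g ξ'
  have e : (Complex.I * cross a b)⁻¹ • L.rep (imQuat (sigmaCoeff a b))
      (complexCovector (L.g X) (L.g X')) = L.rep (imQuat c) (complexCovector (L.g X) (L.g X')) := by
    ext v
    simp only [LinearMap.smul_apply, rep_imQuat_apply, hc, Pi.smul_apply, smul_eq_mul]
    ring
  have e2 : ∀ ξ ξ' : V →L[ℝ] ℝ, -complexCovector ξ ξ' = complexCovector (-ξ) (-ξ') := by
    intro ξ ξ'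
    ext v
    simp [complexCovector_apply]
    ring
  rw [inEigen_iff ha hb, eigen_iff_of_cross_ne_zero ha hb h, e, rep_imQuat_complexCovector, e2,
    complexCovector_inj]
  rfl

/-- On the diagonal, the `+i`-eigenspace is `T^{0,1} ⊕ (T^{1,0})*`. -/
theorem inEigen_diagonal_iff {p : Fin 3 → ℝ} (hp : p 0 ^ 2 + p 1 ^ 2 + p 2 ^ 2 = 1)
    (X X' : V) (ξ ξ' : V →L[ℝ] ℝ) :
    InEigen (gualtieri L.g (L.cplx p) (L.cplx p)) (X, ξ) (X', ξ') ↔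
      X' = L.cplx p X ∧ ∀ v, ξ' v = -ξ (L.cplx p v) := by
  obtain ⟨Y, rfl⟩ := L.exists_eq_g ξ
  obtain ⟨Y', rfl⟩ := L.exists_eq_g ξ'
  have e : (∀ v, L.g Y' v = -L.g Y (L.cplx p v)) ↔ L.cplx p Y = Y' := by
    simp only [← L.skew, ← L.injective.eq_iff, ContinuousLinearMap.ext_iff, eq_comm]
  rw [inEigen_gualtieri_iff L hp hp, e, map_add, map_sub]
  constructor
  · rintro ⟨e1, e2⟩
    constructor
    · linear_combination (norm := module) -(1 / 2 : ℝ) • e1 - (1 / 2 : ℝ) • e2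
    · linear_combination (norm := module) (1 / 2 : ℝ) • e1 - (1 / 2 : ℝ) • e2
  · rintro ⟨rfl, rfl⟩
    exact ⟨rfl, rfl⟩

/-- The vectors of type `(0, 1)` are those annihilated by the holomorphic symplectic form. -/
theorem cplx_stereo_eq_iff {a : Fin 2 → ℂ} (ha : a ≠ 0) (X X' : V) :
    L.cplx (stereo a) X = X' ↔
      L.kahler (fun i => (sigmaCoeff a a i).re) X = L.kahler (fun i => (sigmaCoeff a a i).im) X' ∧
      L.kahler (fun i => (sigmaCoeff a a i).re) X' =
        -L.kahler (fun i => (sigmaCoeff a a i).im) X := by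
  have h := (stereoQuat_eigen_iff (L := L) ha ha (by simp [cross, mul_comm])
    (complexCovector (L.g X) (L.g X'))).1
  have h0 : complexCovector (0 : V →L[ℝ] ℝ) 0 = 0 := by
    ext v
    simp [complexCovector_apply]
  rw [stereoQuat, L.rep_add_I_eq_zero_iff (stereo_normSq ha), rep_imQuat_complexCovector, ← h0,
    complexCovector_inj, sub_eq_zero, ← eq_neg_iff_add_eq_zero] at h
  exact h

end LinearHyperkahler

/-! ### Derivatives along vector fields and closedness of combinations of the Kähler forms. -/

section Calculus

variable {n : ℕ} {M : Type*} [TopologicalSpace M] [ChartedSpace (Model n) M]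
  [IsManifold 𝓘(ℝ, Model n) ∞ M]

theorem SmoothVFAt.mdifferentiableAt {X : ∀ x : M, 𝕋 n x} {x : M} (hX : SmoothVFAt X x) :
    MDifferentiableAt 𝓘(ℝ, Model n) (𝓘(ℝ, Model n).prod 𝓘(ℝ, Model n))
      (fun y => TotalSpace.mk' (Model n) y (X y)) x :=
  ContMDiffAt.mdifferentiableAt hX (by simp)

theorem mdifferentiableAt_inner (g : Metric n M) {X Y : ∀ x : M, 𝕋 n x} {x : M}
    (hX : SmoothVFAt X x) (hY : SmoothVFAt Y x) :
    MDifferentiableAt 𝓘(ℝ, Model n) 𝓘(ℝ, ℝ) (fun y => g.inner y (X y) (Y y)) x := by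
  have h := MDifferentiableAt.clm_bundle_apply₂ (F₁ := Model n) (F₂ := Model n) (F₃ := ℝ)
    (E₁ := 𝕋 n) (E₂ := 𝕋 n) (E₃ := Bundle.Trivial M ℝ) (b := fun y : M => y)
    ((g.contMDiff x).mdifferentiableAt (by simp)) hX.mdifferentiableAt hY.mdifferentiableAt
  simp only [mdifferentiableAt_totalSpace] at h
  exact h.2

theorem along_neg (X : ∀ x : M, 𝕋 n x) (f : M → ℝ) (x : M) :
    along X (fun y => -f y) x = -along X f x := by
  unfold along
  rw [mvfderiv_fun_neg]
  rfl

theorem along_add (X : ∀ x : M, 𝕋 n x) {f h : M → ℝ} {x : M}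
    (hf : MDifferentiableAt 𝓘(ℝ, Model n) 𝓘(ℝ, ℝ) f x)
    (hh : MDifferentiableAt 𝓘(ℝ, Model n) 𝓘(ℝ, ℝ) h x) :
    along X (fun y => f y + h y) x = along X f x + along X h x := by
  unfold along
  rw [mvfderiv_fun_add hf hh]
  rfl

theorem along_const_mul (X : ∀ x : M, 𝕋 n x) {f : M → ℝ} {x : M} (r : ℝ)
    (hf : MDifferentiableAt 𝓘(ℝ, Model n) 𝓘(ℝ, ℝ) f x) :
    along X (fun y => r * f y) x = r * along X f x := by
  unfold along
  rw [mvfderiv_fun_mul mdifferentiableAt_const hf]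
  simp [mvfderiv_const]

namespace Hyperkahler

variable (H : Hyperkahler n M)

theorem smoothVF_cplx (c : Fin 3 → ℝ) {X : ∀ x : M, 𝕋 n x} (hX : SmoothVF X) :
    SmoothVF (fun x => H.cplx c x (X x)) :=
  (((H.kahler_I.smooth.apply hX).const_smul (c 0)).add
    ((H.kahler_J.smooth.apply hX).const_smul (c 1))).add
    ((H.kahler_K.smooth.apply hX).const_smul (c 2))

theorem smoothVFAt_cplx (c : Fin 3 → ℝ) {X : ∀ x : M, 𝕋 n x} {x : M} (hX : SmoothVFAt X x) :
    SmoothVFAt (fun x => H.cplx c x (X x)) x :=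
  (((H.kahler_I.smooth.applyAt hX).const_smul (c 0)).add
    ((H.kahler_J.smooth.applyAt hX).const_smul (c 1))).add
    ((H.kahler_K.smooth.applyAt hX).const_smul (c 2))

theorem mdifferentiableAt_kahler (c : Fin 3 → ℝ) {X Y : ∀ x : M, 𝕋 n x} {x : M}
    (hX : SmoothVFAt X x) (hY : SmoothVFAt Y x) :
    MDifferentiableAt 𝓘(ℝ, Model n) 𝓘(ℝ, ℝ) (fun y => H.kahler c y (X y) (Y y)) x :=
  mdifferentiableAt_inner H.g (H.smoothVFAt_cplx c hX) hY

theorem kahler_skew (c : Fin 3 → ℝ) (x : M) (u v : 𝕋 n x) :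
    H.kahler c x u v = -H.kahler c x v u := by
  rw [show H.kahler c x u v = H.g.inner x (H.cplx c x u) v from rfl, H.g.symm]
  exact (neg_eq_iff_eq_neg.2 ((H.linear x).skew c v u)).symm

theorem kahler_apply (c : Fin 3 → ℝ) (x : M) (u v : 𝕋 n x) :
    H.kahler c x u v = c 0 * H.g.inner x (H.I x u) v + c 1 * H.g.inner x (H.J x u) v +
      c 2 * H.g.inner x (H.K x u) v := by
  simp [kahler, cplx]

theorem along_kahler (c : Fin 3 → ℝ) (W : ∀ x : M, 𝕋 n x) {X Y : ∀ x : M, 𝕋 n x} {x : M}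
    (hX : SmoothVFAt X x) (hY : SmoothVFAt Y x) :
    along W (fun y => H.kahler c y (X y) (Y y)) x =
      c 0 * along W (fun y => H.g.inner y (H.I y (X y)) (Y y)) x +
      c 1 * along W (fun y => H.g.inner y (H.J y (X y)) (Y y)) x +
      c 2 * along W (fun y => H.g.inner y (H.K y (X y)) (Y y)) x := by
  have hI := mdifferentiableAt_inner H.g (H.kahler_I.smooth.applyAt hX) hY
  have hJ := mdifferentiableAt_inner H.g (H.kahler_J.smooth.applyAt hX) hY
  have hK := mdifferentiableAt_inner H.g (H.kahler_K.smooth.applyAt hX) hY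
  simp only [kahler_apply]
  have hI' := (mdifferentiableAt_const (c := c 0)).mul hI
  have hJ' := (mdifferentiableAt_const (c := c 1)).mul hJ
  have hK' := (mdifferentiableAt_const (c := c 2)).mul hK
  refine (along_add W (hI'.add hJ') hK').trans ?_
  refine (congrArg (· + _) (along_add W hI' hJ')).trans ?_
  change along W (fun y => c 0 * _) x + along W (fun y => c 1 * _) x +
    along W (fun y => c 2 * _) x = _
  rw [along_const_mul _ _ hI, along_const_mul _ _ hJ,
    along_const_mul _ _ hK]

theorem isClosed_kahler (c : Fin 3 → ℝ) : IsClosedTwoForm (H.kahler c) := by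
  intro x X Y Z hX hY hZ
  have hI := H.kahler_I.closed x X Y Z hX hY hZ
  have hJ := H.kahler_J.closed x X Y Z hX hY hZ
  have hK := H.kahler_K.closed x X Y Z hX hY hZ
  simp only [ContinuousLinearMap.comp_apply] at hI hJ hK
  rw [H.along_kahler c _ hY hZ, H.along_kahler c _ hX hZ, H.along_kahler c _ hX hY]
  simp only [kahler_apply]
  linear_combination c 0 * hI + c 1 * hJ + c 2 * hK

end Hyperkahler

end Calculus

/-! ### The generalized complex structures of a hyperkähler manifold -/

section GenComplex

variable {n : ℕ} {M : Type*} [TopologicalSpace M] [ChartedSpace (Model n) M]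
  [IsManifold 𝓘(ℝ, Model n) ∞ M]

theorem along_fun_sub (X : ∀ x : M, 𝕋 n x) {f h : M → ℝ} {x : M}
    (hf : MDifferentiableAt 𝓘(ℝ, Model n) 𝓘(ℝ, ℝ) f x)
    (hh : MDifferentiableAt 𝓘(ℝ, Model n) 𝓘(ℝ, ℝ) h x) :
    along X (fun y => f y - h y) x = along X f x - along X h x := by
  unfold along
  rw [mvfderiv_fun_sub hf hh]
  rfl

/-- Local smooth vector fields with prescribed value at a point. -/
theorem exists_smoothVFAt (x : M) (z : 𝕋 n x) :
    ∃ Z : ∀ x : M, 𝕋 n x, SmoothVFAt Z x ∧ Z x = z :=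
  ⟨FiberBundle.extend (Model n) z, FiberBundle.contMDiffAt_extend _ _ z,
    FiberBundle.extend_apply_self _ z⟩

theorem dorfman_snd_apply (e f : GenSection n M) {x : M} {Z : ∀ x : M, 𝕋 n x}
    (hZ : SmoothVFAt Z x) : (dorfman e f x).2 (Z x) = dorfmanEval e f x Z :=
  TensorialAt.mkHom_apply (dorfman_tensorial e f x) hZ.mdifferentiableAt

namespace Hyperkahler

variable (H : Hyperkahler n M)

theorem biHermitian_smooth (α β : CP1) (e : GenSection n M) :
    SmoothVF (fun x => (H.biHermitian α β x (e.at x)).1) ∧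
      SmoothOneForm (fun x => (H.biHermitian α β x (e.at x)).2) := by
  set p := spherePoint α with hp
  set q := spherePoint β with hq
  -- The vector field metrically dual to the one-form part; in terms of it the endomorphism involves
  -- only `g` and the smooth complex structures.
  set Y : ∀ x : M, 𝕋 n x := fun x => (H.linear x).flat.symm (e.form x) with hY
  have hgY : ∀ x, H.g.inner x (Y x) = e.form x := fun x => (H.linear x).g_flat_symm (e.form x)
  have hX := e.smooth_vec
  have hYs : SmoothVF Y := smoothVF_of_inner H.g (fun x => (H.linear x).flat) (fun x u => rfl) (by
    simpa only [hgY] using e.smooth_form)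
  have key : ∀ x, H.biHermitian α β x (e.at x) =
      ((1 / 2 : ℝ) • (-(H.cplx p x (e.vec x) + H.cplx q x (e.vec x)) +
        (H.cplx p x (Y x) - H.cplx q x (Y x))),
      H.g.inner x ((1 / 2 : ℝ) • (H.cplx p x (e.vec x) - H.cplx q x (e.vec x) -
        (H.cplx p x (Y x) + H.cplx q x (Y x))))) := by
    intro x
    have := (H.linear x).gualtieri_apply (spherePoint_normSq α) (spherePoint_normSq β)
      (e.vec x) (Y x)
    rw [show (H.linear x).g (Y x) = e.form x from hgY x] at this
    exact this
  have h1 := H.smoothVF_cplx p hX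
  have h2 := H.smoothVF_cplx q hX
  have h3 := H.smoothVF_cplx p hYs
  have h4 := H.smoothVF_cplx q hYs
  simp only [key]
  constructor
  · exact ContMDiff.congr (((h1.add h2).const_smul (-(1 / 2))).add
      ((h3.add (h4.const_smul (-1))).const_smul (1 / 2)))
      fun x => congrArg (TotalSpace.mk' (Model n) x) (by module)
  · refine smoothOneForm_inner H.g ?_
    exact ContMDiff.congr (((h1.add (h2.const_smul (-1))).const_smul (1 / 2)).add
      ((h3.add h4).const_smul (-(1 / 2))))
      fun x => congrArg (TotalSpace.mk' (Model n) x) (by module)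

/-- The distribution of vectors of type `(0, 1)` is involutive. -/
theorem cplx_lie {a : Fin 2 → ℂ} (ha : a ≠ 0) {X X' Y Y' : ∀ x : M, 𝕋 n x}
    (hX' : ∀ y, X' y = H.cplx (stereo a) y (X y)) (hY' : ∀ y, Y' y = H.cplx (stereo a) y (Y y))
    {x : M} (hX : SmoothVFAt X x) (hY : SmoothVFAt Y x) :
    H.cplx (stereo a) x (lie X Y x - lie X' Y' x) = lie X Y' x + lie X' Y x := by
  set p : Fin 3 → ℝ := fun i => (sigmaCoeff a a i).re with hp
  set q : Fin 3 → ℝ := fun i => (sigmaCoeff a a i).im with hq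
  have hsX' : SmoothVFAt X' x := by
    rw [show X' = _ from funext hX']
    exact H.smoothVFAt_cplx _ hX
  have hsY' : SmoothVFAt Y' x := by
    rw [show Y' = _ from funext hY']
    exact H.smoothVFAt_cplx _ hY
  have rX := fun y => ((H.linear y).cplx_stereo_eq_iff ha (X y) (X' y)).1 (hX' y).symm
  have rY := fun y => ((H.linear y).cplx_stereo_eq_iff ha (Y y) (Y' y)).1 (hY' y).symm
  have pX : ∀ y, H.kahler p y (X y) = H.kahler q y (X' y) := fun y => (rX y).1
  have pX' : ∀ y, H.kahler p y (X' y) = -H.kahler q y (X y) := fun y => (rX y).2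
  have pY : ∀ y, H.kahler p y (Y y) = H.kahler q y (Y' y) := fun y => (rY y).1
  have pY' : ∀ y, H.kahler p y (Y' y) = -H.kahler q y (Y y) := fun y => (rY y).2
  refine ((H.linear x).cplx_stereo_eq_iff ha _ _).2 ⟨?_, ?_⟩ <;>
    refine ContinuousLinearMap.ext fun z => ?_
  · obtain ⟨Z, hZ, rfl⟩ := exists_smoothVFAt x z
    change H.kahler p x _ (Z x) = H.kahler q x _ (Z x)
    have k1 := H.isClosed_kahler p x X Y Z hX hY hZ
    have k2 := H.isClosed_kahler p x X' Y' Z hsX' hsY' hZ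
    have k3 := H.isClosed_kahler q x X Y' Z hX hsY' hZ
    have k4 := H.isClosed_kahler q x X' Y Z hsX' hY hZ
    simp only [pX, pY, pX', pY', neg_apply, along_neg] at k1 k2
    have s := fun u v => H.kahler_skew p x u v
    rw [s _ (Y x), s _ (X x), pX, pY] at k1
    rw [s _ (Y' x), s _ (X' x), pX', pY'] at k2
    have t := fun u v => H.kahler_skew q x u v
    rw [t _ (Y' x), t _ (X x)] at k3
    rw [t _ (Y x), t _ (X' x)] at k4
    simp only [map_add, map_sub, add_apply, sub_apply, neg_apply] at k1 k2 k3 k4 ⊢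
    linear_combination -k1 + k2 + k3 + k4
  · obtain ⟨Z, hZ, rfl⟩ := exists_smoothVFAt x z
    change H.kahler p x _ (Z x) = -H.kahler q x _ (Z x)
    have k1 := H.isClosed_kahler q x X Y Z hX hY hZ
    have k2 := H.isClosed_kahler q x X' Y' Z hsX' hsY' hZ
    have k3 := H.isClosed_kahler p x X Y' Z hX hsY' hZ
    have k4 := H.isClosed_kahler p x X' Y Z hsX' hY hZ
    simp only [pX, pY, pX', pY', neg_apply, along_neg] at k3 k4
    have s := fun u v => H.kahler_skew p x u v
    rw [s _ (Y' x), s _ (X x), pX, pY'] at k3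
    rw [s _ (Y x), s _ (X' x), pX', pY] at k4
    have t := fun u v => H.kahler_skew q x u v
    rw [t _ (Y x), t _ (X x)] at k1
    rw [t _ (Y' x), t _ (X' x)] at k2
    simp only [map_add, map_sub, add_apply, sub_apply, neg_apply] at k1 k2 k3 k4 ⊢
    linear_combination -k1 + k2 - k3 - k4

/-- The eigenbundle is the graph of `-B` for the closed complex two-form `B = p + iq`. The bracket
of two sections of such a graph differs from the section over the bracket of their vector parts by a
contraction of `dB`. -/
theorem involutive_of_cross_ne_zero {a b : Fin 2 → ℂ} (ha : a ≠ 0) (hb : b ≠ 0)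
    (h : cross a b ≠ 0) (s s' t t' : GenSection n M)
    (hs : ∀ x, InEigen (H.biHermitian (Projectivization.mk ℂ b hb) (Projectivization.mk ℂ a ha) x)
      (s.at x) (s'.at x))
    (ht : ∀ x, InEigen (H.biHermitian (Projectivization.mk ℂ b hb) (Projectivization.mk ℂ a ha) x)
      (t.at x) (t'.at x)) (x : M) :
    InEigen (H.biHermitian (Projectivization.mk ℂ b hb) (Projectivization.mk ℂ a ha) x)
      (dorfman s t x - dorfman s' t' x) (dorfman s t' x + dorfman s' t x) := by
  set p : Fin 3 → ℝ := fun i => (((Complex.I * cross a b)⁻¹ • sigmaCoeff a b) i).re with hp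
  set q : Fin 3 → ℝ := fun i => (((Complex.I * cross a b)⁻¹ • sigmaCoeff a b) i).im with hq
  have key := fun y => (H.linear y).inEigen_iff_of_cross_ne_zero ha hb h rfl
  have hs1 := fun y => ((key y _ _ _ _).1 (hs y)).1
  have hs2 := fun y => ((key y _ _ _ _).1 (hs y)).2
  have ht1 := fun y => ((key y _ _ _ _).1 (ht y)).1
  have ht2 := fun y => ((key y _ _ _ _).1 (ht y)).2
  have hX : SmoothVFAt s.vec x := s.smooth_vec x
  have hX' : SmoothVFAt s'.vec x := s'.smooth_vec x
  have hY : SmoothVFAt t.vec x := t.smooth_vec x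
  have hY' : SmoothVFAt t'.vec x := t'.smooth_vec x
  have es1 : ∀ y v, s.form y v = -(H.kahler p y (s.vec y) v - H.kahler q y (s'.vec y) v) :=
    fun y v => congrArg (fun f => f v) (hs1 y)
  have es2 : ∀ y v, s'.form y v = -(H.kahler p y (s'.vec y) v + H.kahler q y (s.vec y) v) :=
    fun y v => congrArg (fun f => f v) (hs2 y)
  have et1 : ∀ y v, t.form y v = -(H.kahler p y (t.vec y) v - H.kahler q y (t'.vec y) v) :=
    fun y v => congrArg (fun f => f v) (ht1 y)
  have et2 : ∀ y v, t'.form y v = -(H.kahler p y (t'.vec y) v + H.kahler q y (t.vec y) v) :=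
    fun y v => congrArg (fun f => f v) (ht2 y)
  have eval1 : ∀ (W : ∀ x : M, 𝕋 n x) {X X' Z : ∀ x : M, 𝕋 n x}, SmoothVFAt X x →
      SmoothVFAt X' x → SmoothVFAt Z x →
      along W (fun y => -(H.kahler p y (X y) (Z y) - H.kahler q y (X' y) (Z y))) x =
        -(along W (fun y => H.kahler p y (X y) (Z y)) x -
          along W (fun y => H.kahler q y (X' y) (Z y)) x) := by
    intro W X X' Z hX hX' hZ
    rw [along_neg, along_fun_sub _ (H.mdifferentiableAt_kahler p hX hZ)
      (H.mdifferentiableAt_kahler q hX' hZ)]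
  have eval2 : ∀ (W : ∀ x : M, 𝕋 n x) {X X' Z : ∀ x : M, 𝕋 n x}, SmoothVFAt X x →
      SmoothVFAt X' x → SmoothVFAt Z x →
      along W (fun y => -(H.kahler p y (X' y) (Z y) + H.kahler q y (X y) (Z y))) x =
        -(along W (fun y => H.kahler p y (X' y) (Z y)) x +
          along W (fun y => H.kahler q y (X y) (Z y)) x) := by
    intro W X X' Z hX hX' hZ
    rw [along_neg, along_add _ (H.mdifferentiableAt_kahler p hX' hZ)
      (H.mdifferentiableAt_kahler q hX hZ)]
  have sp := fun u v => H.kahler_skew p x u v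
  have sq := fun u v => H.kahler_skew q x u v
  refine (key x (lie s.vec t.vec x - lie s'.vec t'.vec x)
    (lie s.vec t'.vec x + lie s'.vec t.vec x) _ _).2 ⟨?_, ?_⟩ <;>
    refine ContinuousLinearMap.ext fun z => ?_ <;>
    obtain ⟨Z, hZ, rfl⟩ := exists_smoothVFAt x z
  · change (dorfman s t x).2 (Z x) - (dorfman s' t' x).2 (Z x) =
      -(H.kahler p x _ (Z x) - H.kahler q x _ (Z x))
    rw [dorfman_snd_apply _ _ hZ, dorfman_snd_apply _ _ hZ]
    -- These four identities make up the real part of `dB = 0` on the complex fields `s + i s'` and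
    -- `t + i t'`.
    have k1 := H.isClosed_kahler p x _ _ Z hX hY hZ
    have k2 := H.isClosed_kahler p x _ _ Z hX' hY' hZ
    have k3 := H.isClosed_kahler q x _ _ Z hX hY' hZ
    have k4 := H.isClosed_kahler q x _ _ Z hX' hY hZ
    simp only [dorfmanEval, es1, es2, et1, et2]
    rw [eval1 _ hY hY' hZ, eval1 _ hX hX' hZ, eval1 _ hX hX' hY, eval2 _ hY hY' hZ,
      eval2 _ hX hX' hZ, eval2 _ hX hX' hY']
    rw [sp _ (t.vec x), sp _ (s.vec x)] at k1
    rw [sp _ (t'.vec x), sp _ (s'.vec x)] at k2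
    rw [sq _ (t'.vec x), sq _ (s.vec x)] at k3
    rw [sq _ (t.vec x), sq _ (s'.vec x)] at k4
    simp only [map_add, map_sub, add_apply, sub_apply]
    linear_combination -k1 + k2 + k3 + k4
  · change (dorfman s t' x).2 (Z x) + (dorfman s' t x).2 (Z x) =
      -(H.kahler p x _ (Z x) + H.kahler q x _ (Z x))
    rw [dorfman_snd_apply _ _ hZ, dorfman_snd_apply _ _ hZ]
    -- These make up the imaginary part.
    have k1 := H.isClosed_kahler q x _ _ Z hX hY hZ
    have k2 := H.isClosed_kahler q x _ _ Z hX' hY' hZ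
    have k3 := H.isClosed_kahler p x _ _ Z hX hY' hZ
    have k4 := H.isClosed_kahler p x _ _ Z hX' hY hZ
    simp only [dorfmanEval, es1, es2, et1, et2]
    rw [eval1 _ hY hY' hZ, eval1 _ hX hX' hZ, eval1 _ hX hX' hY', eval2 _ hY hY' hZ,
      eval2 _ hX hX' hZ, eval2 _ hX hX' hY]
    rw [sq _ (t.vec x), sq _ (s.vec x)] at k1
    rw [sq _ (t'.vec x), sq _ (s'.vec x)] at k2
    rw [sp _ (t'.vec x), sp _ (s.vec x)] at k3
    rw [sp _ (t.vec x), sp _ (s'.vec x)] at k4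
    simp only [map_add, map_sub, add_apply, sub_apply]
    linear_combination -k1 + k2 - k3 - k4

/-- Brackets of `(0, 1)` fields are of type `(0, 1)` by `cplx_lie`. The covector parts are the
annihilator of `T^{0,1}`, so the form part of the bracket, tested on a `(0, 1)` field, has all its
terms zero. -/
theorem involutive_diagonal {a : Fin 2 → ℂ} (ha : a ≠ 0) (s s' t t' : GenSection n M)
    (hs : ∀ x, InEigen (H.biHermitian (Projectivization.mk ℂ a ha) (Projectivization.mk ℂ a ha) x)
      (s.at x) (s'.at x))
    (ht : ∀ x, InEigen (H.biHermitian (Projectivization.mk ℂ a ha) (Projectivization.mk ℂ a ha) x)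
      (t.at x) (t'.at x)) (x : M) :
    InEigen (H.biHermitian (Projectivization.mk ℂ a ha) (Projectivization.mk ℂ a ha) x)
      (dorfman s t x - dorfman s' t' x) (dorfman s t' x + dorfman s' t x) := by
  have key := fun y => (H.linear y).inEigen_diagonal_iff (stereo_normSq ha)
  have eX : ∀ y, s'.vec y = H.cplx (stereo a) y (s.vec y) :=
    fun y => ((key y _ _ _ _).1 (hs y)).1
  have eY : ∀ y, t'.vec y = H.cplx (stereo a) y (t.vec y) :=
    fun y => ((key y _ _ _ _).1 (ht y)).1
  have es : ∀ y v, s'.form y v = -s.form y (H.cplx (stereo a) y v) :=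
    fun y => ((key y _ _ _ _).1 (hs y)).2
  have et : ∀ y v, t'.form y v = -t.form y (H.cplx (stereo a) y v) :=
    fun y => ((key y _ _ _ _).1 (ht y)).2
  have sq : ∀ y v, H.cplx (stereo a) y (H.cplx (stereo a) y v) = -v := by
    intro y v
    refine ((H.linear y).cplx_cplx (stereo a) v).trans ?_
    rw [stereo_normSq ha, neg_one_smul]
  have hX : SmoothVFAt s.vec x := s.smooth_vec x
  have hY : SmoothVFAt t.vec x := t.smooth_vec x
  refine (key x (lie s.vec t.vec x - lie s'.vec t'.vec x)
    (lie s.vec t'.vec x + lie s'.vec t.vec x) _ _).2 ⟨(H.cplx_lie ha eX eY hX hY).symm,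
    fun z => ?_⟩
  obtain ⟨Z, hZ, rfl⟩ := exists_smoothVFAt x z
  -- With this choice `Z + iZ'` is of type `(0, 1)`, and it serves as the test field.
  set Z' : ∀ x : M, 𝕋 n x := fun y => H.cplx (stereo a) y (Z y) with hZ'
  have hsZ' : SmoothVFAt Z' x := H.smoothVFAt_cplx _ hZ
  change (dorfman s t' x).2 (Z x) + (dorfman s' t x).2 (Z x) =
    -((dorfman s t x).2 (Z' x) - (dorfman s' t' x).2 (Z' x))
  rw [dorfman_snd_apply _ _ hZ, dorfman_snd_apply _ _ hZ, dorfman_snd_apply _ _ hsZ',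
    dorfman_snd_apply _ _ hsZ']
  -- The brackets of both sections with `Z + iZ'` are again of type `(0, 1)`; these are the only
  -- bracket terms that do not cancel at once.
  have l1 := congrArg (t.form x) (H.cplx_lie ha eX (fun _ => rfl : ∀ y, Z' y = _) hX hZ)
  have l2 := congrArg (s.form x) (H.cplx_lie ha eY (fun _ => rfl : ∀ y, Z' y = _) hY hZ)
  have fsZ : ∀ y, s'.form y (Z y) = -s.form y (Z' y) := fun y => es y _
  have ftZ : ∀ y, t'.form y (Z y) = -t.form y (Z' y) := fun y => et y _
  have fsZ' : ∀ y, s'.form y (Z' y) = s.form y (Z y) := fun y => by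
    rw [es, hZ', sq, map_neg, neg_neg]
  have ftZ' : ∀ y, t'.form y (Z' y) = t.form y (Z y) := fun y => by
    rw [et, hZ', sq, map_neg, neg_neg]
  have fY : ∀ y, s'.form y (t.vec y) = -s.form y (t'.vec y) := fun y => by rw [es, eY]
  have fY' : ∀ y, s'.form y (t'.vec y) = s.form y (t.vec y) := fun y => by
    rw [es, eY, sq, map_neg, neg_neg]
  simp only [dorfmanEval, fsZ, ftZ, fsZ', ftZ', fY, fY', along_neg]
  simp only [es, et]
  simp only [map_sub, map_add] at l1 l2
  linear_combination l1 - l2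

theorem isGenComplex_biHermitian (α β : CP1) : IsGenComplex (H.biHermitian α β) where
  smooth := H.biHermitian_smooth α β
  orthogonal x u v := (H.linear x).pairing_gualtieri (spherePoint_normSq α) (spherePoint_normSq β)
    u v
  sq x u := (H.linear x).gualtieri_gualtieri (spherePoint_normSq α) (spherePoint_normSq β) u
  involutive := by
    induction α using Projectivization.ind with | h b hb =>
    induction β using Projectivization.ind with | h a ha =>
    by_cases h : cross a b = 0
    · have e : Projectivization.mk ℂ b hb = Projectivization.mk ℂ a ha := by
        have h' : a 0 * b 1 = a 1 * b 0 := sub_eq_zero.1 h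
        obtain ⟨i, hi⟩ := Function.ne_iff.1 ha
        rw [Projectivization.mk_eq_mk_iff']
        refine ⟨b i / a i, ?_⟩
        ext j
        simp only [Pi.zero_apply] at hi
        simp only [Pi.smul_apply, smul_eq_mul]
        rw [div_mul_eq_mul_div, div_eq_iff hi]
        fin_cases i <;> fin_cases j <;> simp only [Fin.zero_eta, Fin.mk_one] <;>
          first | ring1 | linear_combination h' | linear_combination -h'
      rw [e]
      exact H.involutive_diagonal ha
    · exact H.involutive_of_cross_ne_zero ha hb h

theorem eq_biHermitian_iff {a b : Fin 2 → ℂ} (ha : a ≠ 0) (hb : b ≠ 0) (𝒥 : GenEnd n M) :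
    (IsGenComplex 𝒥 ∧ ∀ x, IsPureSpinor (𝒥 x) (H.rotationSpinor a b x)) ↔
      𝒥 = H.biHermitian (Projectivization.mk ℂ b hb) (Projectivization.mk ℂ a ha) := by
  constructor
  · rintro ⟨h1, h2⟩
    exact funext fun x => (h2 x).unique (H.isPureSpinor_rotationSpinor ha hb x) (h1.sq x)
  · rintro rfl
    exact ⟨H.isGenComplex_biHermitian _ _, H.isPureSpinor_rotationSpinor ha hb⟩

end Hyperkahler

end GenComplex

end GenTwistor

end

theorem mainTheorem3 {n : ℕ} {M : Type*} [TopologicalSpace M] [T2Space M] [SigmaCompactSpace M]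
    [ChartedSpace (Model n) M] [IsManifold 𝓘(ℝ, Model n) ∞ M] (H : Hyperkahler n M) :
    (∀ α β : CP1, IsGenComplex (H.biHermitian α β)) ∧
    ((∀ (η : ℂ) (ζ : CP1),
        H.rotation η ζ = H.biHermitian (rotationMap η ζ).1 (rotationMap η ζ).2) ∧
      ∀ p : CP1 × CP1, ∃ (η : ℂ) (ζ : CP1), rotationMap η ζ = p) ∧
    (∀ (a b : Fin 2 → ℂ) (ha : a ≠ 0) (hb : b ≠ 0) (𝒥 : GenEnd n M),
      (IsGenComplex 𝒥 ∧ ∀ x, IsPureSpinor (𝒥 x) (H.rotationSpinor a b x)) ↔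
        𝒥 = H.biHermitian (Projectivization.mk ℂ b hb) (Projectivization.mk ℂ a ha)) ∧
    (n = 1 →
      (∀ (a b : Fin 2 → ℂ) (ha : a ≠ 0) (hb : b ≠ 0) (𝒥 : GenEnd n M),
        (IsGenComplex 𝒥 ∧ ∀ x, IsPureSpinor (𝒥 x) (H.mukaiElement (quadricPoint a b) x)) ↔
          𝒥 = H.biHermitian (Projectivization.mk ℂ b hb) (Projectivization.mk ℂ a ha)) ∧
      (∀ (x : M) (c : Fin 4 → ℂ), c ≠ 0 →
        (mukai (H.mukaiElement c x) (H.mukaiElement c x) = 0 ↔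
          ∃! p : CP1 × CP1, ∃ (a b : Fin 2 → ℂ) (ha : a ≠ 0) (hb : b ≠ 0),
            p = (Projectivization.mk ℂ a ha, Projectivization.mk ℂ b hb) ∧
              c = quadricPoint a b))) := by
  refine ⟨H.isGenComplex_biHermitian, ⟨H.rotation_eq_biHermitian, rotationMap_surjective⟩,
    fun a b ha hb 𝒥 => H.eq_biHermitian_iff ha hb 𝒥, ?_⟩
  rintro rfl
  refine ⟨fun a b ha hb 𝒥 => ?_, fun x c hc => ?_⟩
  · have h : ∀ x, H.mukaiElement (quadricPoint a b) x = H.rotationSpinor a b x := fun x => by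
      rw [H.rotationSpinor_eq, (H.linear x).spinor_one_eq (finrank_tangentSpace x), H.mukaiElement_eq]
    simp only [h]
    exact H.eq_biHermitian_iff ha hb 𝒥
  · rw [H.mukaiElement_eq, (H.linear x).mukai_eq_zero_iff (finrank_tangentSpace x)]
    exact quadric_iff_existsUnique hc
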